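/- Let $(X,d)$ be a compact metric space with more than one point and let $\mu$ be a finite Borel measure on $X$ that is Ahlfors $d_f$-regular for some $d_f>0$: there is $C\ge 1$ with $C^{-1}r^{d_f}\le\mu(\overline B(x,r))\le Cr^{d_f}$ for all $x\in X$ and $0\le r<\operatorname{diam}X$. For $a>0$ let $\mathcal H_a$ be the space of $f\in L^2(X,\mu)$ with $\int_X\int_X\frac{|f(x)-f(y)|^2}{d(x,y)^{d_f+2a}}\,d\mu(y)\,d\mu(x)<\infty$, and on it consider the form $$\mathcal E_a(f,g)=\frac12\int_X\int_X\frac{\overline{(f(x)-f(y))}\,(g(x)-g(y))}{d(x,y)^{d_f+2a}}\,d\mu(y)\,d\mu(x).$$ The walk dimension $d_w\in[0,\infty]$ is the supremum of all $2a>0$ for which, with real scalars, there is a subspace $\mathcal F_a\subset\mathcal H_a$, closed for the norm $(\|f\|_{L^2}^2+\mathcal E_a(f,f))^{1/2}$, such that $\mathcal E_a$ restricted to $\mathcal F_a$ is a regular Dirichlet form on $L^2(X,\mu)$. With complex scalars, $\Delta_a$ denotes the positive self-adjoint operator on $L^2(X,\mu)$ associated with the form $\mathcal E_a$ on $\mathcal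 H_a$ (when $\mathcal H_a$ is dense in $L^2(X,\mu)$, which is the case for $a=\alpha,\beta$ below), $C(\mathcal E_a)=\mathcal H_a\cap C(X)$, and $m_f$ is multiplication by $f$. Assume $d_w>d_f$, $0<2\alpha<\min\{(d_w-d_f)/2,\,1\}$, and put $\beta=d_f/2+2\alpha$. Then: (i) for every $f\in C(\mathcal E_\beta)$ the operator $m_f$ preserves $\operatorname{Dom}\Delta_\alpha$ and $[\Delta_\alpha,m_f]$ extends to a Hilbert--Schmidt operator $\operatorname{cl}([\Delta_\alpha,m_f])$ on $L^2(X,\mu)$; (ii) $L^2(X,\mu)$ has an orthonormal basis $(h_n)_{n\ge0}$ of continuous eigenfunctions of $\Delta_\beta$, with eigenvalues $\lambda_0\le\lambda_1\le\cdots$; (iii) for every such basis, $\lambda_0=0<\lambda_1$, and for all states $\tau_1,\tau_2$ of the $C^*$-algebra $C(X)$ the Monge--Kantorovich distance $$\rho(\tau_1,\tau_2)=\sup\{|\tau_1(f)-\tau_2(f)|:\ f\in C(\mathcal E_\beta),\ \|\operatorname{cl}([\Delta_\alpha,m_f])\|_{\mathcal S_2}\le1\}$$ is finite and given by $$\rho(\tau_1,\tau_2)=\Big(\frac12\sum_{n=1}^\infty\lambda_n^{-1}\,|(\tau_1-\tau_2)(h_n)|^2\Big)^{1/2}.$$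 -/

import Mathlib

open MeasureTheory Filter Topology
open scoped ENNReal InnerProductSpace ComplexOrder

set_option linter.unusedSectionVars false

noncomputable section

namespace FracLap

/-! ### Ahlfors regularity -/

/-- The measure `μ` is Ahlfors regular of dimension `df`: there is `C ≥ 1` with
`C⁻¹ r ^ df ≤ μ (closed ball of radius r) ≤ C r ^ df` for all centres and `0 ≤ r < diam X`. -/
def IsAhlforsRegular {X : Type*} [MetricSpace X] [MeasurableSpace X]
    (μ : Measure X) (df : ℝ) : Prop :=
  ∃ C : ℝ, 1 ≤ C ∧ ∀ (x : X) (r : ℝ), 0 ≤ r → r < Metric.diam (Set.univ : Set X) →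
    ENNReal.ofReal (C⁻¹ * r ^ df) ≤ μ (Metric.closedBall x r) ∧
      μ (Metric.closedBall x r) ≤ ENNReal.ofReal (C * r ^ df)

section Form

variable {X : Type*} [MetricSpace X] [MeasurableSpace X] {𝕜 : Type*} [RCLike 𝕜]

/-! ### Fractional Sobolev spaces and forms -/

/-- The double integral `∬ |f x - f y|² / d(x,y) ^ (df + 2a)`, with values in `[0, ∞]`.
The integrand is `0` on the diagonal. -/
def energy (μ : Measure X) (df a : ℝ) (f : X → 𝕜) : ℝ≥0∞ :=
  ∫⁻ p : X × X, ‖f p.1 - f p.2‖ₑ ^ 2 / ENNReal.ofReal (dist p.1 p.2 ^ (df + 2 * a)) ∂(μ.prod μ)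

/-- The form `½ ∬ conj (f x - f y) (g x - g y) / d(x,y) ^ (df + 2a)` on classes of functions. -/
def form (μ : Measure X) (df a : ℝ) (f g : Lp 𝕜 2 μ) : 𝕜 :=
  (1 / 2 : 𝕜) * ∫ p : X × X, (starRingEnd 𝕜) (f p.1 - f p.2) * (g p.1 - g p.2) /
    ((dist p.1 p.2 ^ (df + 2 * a) : ℝ) : 𝕜) ∂(μ.prod μ)

theorem energy_congr {μ : Measure X} [SFinite μ] {df a : ℝ} {f g : X → 𝕜} (h : f =ᵐ[μ] g) :
    energy μ df a f = energy μ df a g := by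
  refine lintegral_congr_ae ?_
  filter_upwards [Measure.quasiMeasurePreserving_fst.ae h,
    Measure.quasiMeasurePreserving_snd.ae h] with p h1 h2
  rw [h1, h2]

variable [CompactSpace X] [BorelSpace X]

theorem aemeasurable_weight (μ : Measure X) (s : ℝ) :
    AEMeasurable (fun p : X × X => ENNReal.ofReal (dist p.1 p.2 ^ s)) (μ.prod μ) := by
  have : Measurable (fun p : X × X => dist p.1 p.2) := continuous_dist.measurable
  exact (this.pow_const s).ennreal_ofReal.aemeasurable

theorem aestronglyMeasurable_diff {μ : Measure X} [SFinite μ] (f : Lp 𝕜 2 μ) :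
    AEStronglyMeasurable (fun p : X × X => f p.1 - f p.2) (μ.prod μ) :=
  (Lp.aestronglyMeasurable f).comp_fst.sub (Lp.aestronglyMeasurable f).comp_snd

theorem energy_add_lt_top {μ : Measure X} [SFinite μ] {df a : ℝ} {f g : Lp 𝕜 2 μ}
    (hf : energy μ df a f < ∞) (hg : energy μ df a g < ∞) :
    energy μ df a (f + g : Lp 𝕜 2 μ) < ∞ := by
  rw [energy_congr (Lp.coeFn_add f g)]
  have hb : energy μ df a (⇑f + ⇑g) ≤ 2 * energy μ df a f + 2 * energy μ df a g := by
    unfold energy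
    rw [← lintegral_const_mul' _ _ (by simp), ← lintegral_const_mul' _ _ (by simp),
      ← lintegral_add_left']
    · refine lintegral_mono fun p => ?_
      rw [← mul_div_assoc, ← mul_div_assoc, ← ENNReal.add_div]
      refine ENNReal.div_le_div_right ?_ _
      have h1 : ‖(⇑f + ⇑g) p.1 - (⇑f + ⇑g) p.2‖ₑ ≤ ‖f p.1 - f p.2‖ₑ + ‖g p.1 - g p.2‖ₑ := by
        refine le_trans (le_of_eq ?_) (enorm_add_le _ _)
        simp only [Pi.add_apply]
        congr 1
        ring
      refine (pow_le_pow_left' h1 2).trans ?_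
      have h2 := ENNReal.rpow_add_le_mul_rpow_add_rpow ‖f p.1 - f p.2‖ₑ ‖g p.1 - g p.2‖ₑ
        (p := 2) (by norm_num)
      norm_num at h2
      rwa [mul_add] at h2
    · exact (((aestronglyMeasurable_diff f).enorm.pow_const 2).div
        (aemeasurable_weight μ _)).const_mul 2
  exact hb.trans_lt (ENNReal.add_lt_top.2
    ⟨ENNReal.mul_lt_top (by simp) hf, ENNReal.mul_lt_top (by simp) hg⟩)

theorem energy_smul_lt_top {μ : Measure X} [SFinite μ] {df a : ℝ} (c : 𝕜) {f : Lp 𝕜 2 μ}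
    (hf : energy μ df a f < ∞) : energy μ df a (c • f : Lp 𝕜 2 μ) < ∞ := by
  rw [energy_congr (Lp.coeFn_smul c f)]
  have hb : energy μ df a (c • ⇑f) = ‖c‖ₑ ^ 2 * energy μ df a f := by
    unfold energy
    rw [← lintegral_const_mul' _ _ (by simp)]
    refine lintegral_congr fun p => ?_
    simp only [Pi.smul_apply, ← smul_sub, enorm_smul, mul_pow, mul_div_assoc]
  rw [hb]
  exact ENNReal.mul_lt_top (by simp) hf

/-- The fractional Sobolev space `H_a`: the classes in `L²(X, μ)` of finite energy. -/
def sobolev (𝕜 : Type*) [RCLike 𝕜] (μ : Measure X) [SFinite μ] (df a : ℝ) :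
    Submodule 𝕜 (Lp 𝕜 2 μ) where
  carrier := {f | energy μ df a f < ∞}
  add_mem' hf hg := energy_add_lt_top hf hg
  zero_mem' := by
    change energy μ df a _ < ∞
    rw [energy_congr (Lp.coeFn_zero 𝕜 2 μ)]
    simp [energy]
  smul_mem' c _ hf := energy_smul_lt_top c hf

theorem integrable_form {μ : Measure X} [SFinite μ] {df a : ℝ} {f g : Lp 𝕜 2 μ}
    (hf : f ∈ sobolev 𝕜 μ df a) (hg : g ∈ sobolev 𝕜 μ df a) :
    Integrable (fun p : X × X => (starRingEnd 𝕜) (f p.1 - f p.2) * (g p.1 - g p.2) /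
      ((dist p.1 p.2 ^ (df + 2 * a) : ℝ) : 𝕜)) (μ.prod μ) := by
  have hw : Measurable (fun p : X × X => ((dist p.1 p.2 ^ (df + 2 * a) : ℝ) : 𝕜)) := by
    have : Measurable (fun p : X × X => dist p.1 p.2) := continuous_dist.measurable
    exact RCLike.measurable_ofReal.comp (this.pow_const _)
  refine ⟨?_, ?_⟩
  · have h1 := (RCLike.continuous_conj (K := 𝕜)).comp_aestronglyMeasurable
      (aestronglyMeasurable_diff f)
    exact ((h1.mul (aestronglyMeasurable_diff g)).aemeasurable.div
      hw.aemeasurable).aestronglyMeasurable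
  · have hle : ∫⁻ p : X × X, ‖(starRingEnd 𝕜) (f p.1 - f p.2) * (g p.1 - g p.2) /
        ((dist p.1 p.2 ^ (df + 2 * a) : ℝ) : 𝕜)‖ₑ ∂(μ.prod μ) ≤
        energy μ df a f + energy μ df a g := by
      unfold energy
      rw [← lintegral_add_left' (by
        exact ((aestronglyMeasurable_diff f).enorm.pow_const 2).div (aemeasurable_weight μ _))]
      refine lintegral_mono fun p => ?_
      rcases eq_or_ne p.1 p.2 with h | h
      · simp [h]
      have hd : 0 < dist p.1 p.2 ^ (df + 2 * a) := Real.rpow_pos_of_pos (dist_pos.2 h) _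
      rw [← ENNReal.add_div, ← ofReal_norm, ← ofReal_norm,
        ← ofReal_norm, ← ENNReal.ofReal_pow (norm_nonneg _),
        ← ENNReal.ofReal_pow (norm_nonneg _), ← ENNReal.ofReal_add (by positivity) (by positivity),
        ← ENNReal.ofReal_div_of_pos hd]
      refine ENNReal.ofReal_le_ofReal ?_
      rw [norm_div, norm_mul, RCLike.norm_conj, RCLike.norm_ofReal, abs_of_pos hd]
      gcongr
      nlinarith [sq_nonneg (‖f p.1 - f p.2‖ - ‖g p.1 - g p.2‖),
        sq_nonneg (‖f p.1 - f p.2‖), sq_nonneg (‖g p.1 - g p.2‖)]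
    exact hle.trans_lt (ENNReal.add_lt_top.2 ⟨hf, hg⟩)

theorem form_add_right {μ : Measure X} [SFinite μ] {df a : ℝ} {v f g : Lp 𝕜 2 μ}
    (hv : v ∈ sobolev 𝕜 μ df a) (hf : f ∈ sobolev 𝕜 μ df a) (hg : g ∈ sobolev 𝕜 μ df a) :
    form μ df a v (f + g) = form μ df a v f + form μ df a v g := by
  unfold form
  rw [← mul_add, ← integral_add (integrable_form hv hf) (integrable_form hv hg)]
  congr 1
  refine integral_congr_ae ?_
  filter_upwards [Measure.quasiMeasurePreserving_fst.ae (Lp.coeFn_add f g),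
    Measure.quasiMeasurePreserving_snd.ae (Lp.coeFn_add f g)] with p h1 h2
  rw [h1, h2]
  simp only [Pi.add_apply]
  ring

theorem form_smul_right {μ : Measure X} [SFinite μ] {df a : ℝ} (c : 𝕜) (v f : Lp 𝕜 2 μ) :
    form μ df a v (c • f) = c * form μ df a v f := by
  unfold form
  rw [mul_left_comm, ← integral_const_mul (μ := μ.prod μ) c]
  congr 1
  refine integral_congr_ae ?_
  filter_upwards [Measure.quasiMeasurePreserving_fst.ae (Lp.coeFn_smul c f),
    Measure.quasiMeasurePreserving_snd.ae (Lp.coeFn_smul c f)] with p h1 h2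
  rw [h1, h2]
  simp only [Pi.smul_apply, smul_eq_mul]
  ring

/-- The square of the form norm, `‖f‖² + E_a(f, f)`. -/
def formNormSq (μ : Measure X) (df a : ℝ) (f : Lp 𝕜 2 μ) : ℝ :=
  ‖f‖ ^ 2 + RCLike.re (form μ df a f f)

/-! ### Regular Dirichlet forms and the walk dimension (real scalars) -/

/-- `g` is a normal contraction of `f`. -/
def IsNormalContraction (μ : Measure X) (g f : Lp ℝ 2 μ) : Prop :=
  ∀ᵐ p : X × X ∂(μ.prod μ), |g p.1| ≤ |f p.1| ∧ |g p.1 - g p.2| ≤ |f p.1 - f p.2|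

/-- The restriction of `E_a` to the subspace `F` of `H_a` is a Dirichlet form: it is densely
defined, closed (i.e. `F` is complete for the form norm), and normal contractions operate on it. -/
structure IsDirichletForm (μ : Measure X) [IsFiniteMeasure μ] (df a : ℝ)
    (F : Submodule ℝ (Lp ℝ 2 μ)) : Prop where
  le_sobolev : F ≤ sobolev ℝ μ df a
  dense : Dense (F : Set (Lp ℝ 2 μ))
  complete : ∀ u : ℕ → Lp ℝ 2 μ, (∀ n, u n ∈ F) →
    (∀ ε : ℝ, 0 < ε → ∃ N, ∀ m, N ≤ m → ∀ n, N ≤ n → formNormSq μ df a (u m - u n) < ε) →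
    ∃ f ∈ F, Tendsto (fun n => formNormSq μ df a (u n - f)) atTop (𝓝 0)
  contraction : ∀ f ∈ F, ∀ g : Lp ℝ 2 μ, IsNormalContraction μ g f →
    g ∈ F ∧ form μ df a g g ≤ form μ df a f f

/-- The restriction of `E_a` to `F` is a regular Dirichlet form: `F ∩ C(X)` is dense in `F` for
the form norm and dense in `C(X)` for the supremum norm. -/
structure IsRegularDirichletForm (μ : Measure X) [IsFiniteMeasure μ] (df a : ℝ)
    (F : Submodule ℝ (Lp ℝ 2 μ)) : Prop extends IsDirichletForm μ df a F where
  dense_form : ∀ f ∈ F, ∀ ε : ℝ, 0 < ε → ∃ φ : C(X, ℝ),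
    ContinuousMap.toLp (E := ℝ) 2 μ ℝ φ ∈ F ∧
      formNormSq μ df a (ContinuousMap.toLp (E := ℝ) 2 μ ℝ φ - f) < ε
  dense_sup : Dense {φ : C(X, ℝ) | ContinuousMap.toLp (E := ℝ) 2 μ ℝ φ ∈ F}

/-- `F` is closed in `H_a` for the form norm. -/
def IsFormClosed (μ : Measure X) [IsFiniteMeasure μ] (df a : ℝ)
    (F : Submodule ℝ (Lp ℝ 2 μ)) : Prop :=
  ∀ (u : ℕ → Lp ℝ 2 μ) (f : Lp ℝ 2 μ), (∀ n, u n ∈ F) → f ∈ sobolev ℝ μ df a →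
    Tendsto (fun n => formNormSq μ df a (u n - f)) atTop (𝓝 0) → f ∈ F

/-- The walk dimension, in `[0, ∞]`: the supremum of the numbers `2a > 0` for which `E_a` is a
regular Dirichlet form on some closed subspace of `H_a`. -/
def walkDim (μ : Measure X) [IsFiniteMeasure μ] (df : ℝ) : ℝ≥0∞ :=
  sSup {s | ∃ a : ℝ, 0 < a ∧ s = ENNReal.ofReal (2 * a) ∧ ∃ F : Submodule ℝ (Lp ℝ 2 μ),
    F ≤ sobolev ℝ μ df a ∧ IsFormClosed μ df a F ∧ IsRegularDirichletForm μ df a F}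

/-! ### The fractional Dirichlet Laplacian (complex scalars) -/

/-- The graph of the operator associated with the form `E_a`: the pairs `(u, w)` with `u ∈ H_a`
and `E_a(v, u) = ⟪v, w⟫` for all `v ∈ H_a`. -/
def laplacianGraph (μ : Measure X) [IsFiniteMeasure μ] (df a : ℝ) :
    Submodule ℂ (Lp ℂ 2 μ × Lp ℂ 2 μ) where
  carrier := {p | p.1 ∈ sobolev ℂ μ df a ∧
    ∀ v ∈ sobolev ℂ μ df a, form μ df a v p.1 = ⟪v, p.2⟫_ℂ}
  add_mem' := by
    rintro p q ⟨hp, hp'⟩ ⟨hq, hq'⟩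
    refine ⟨Submodule.add_mem _ hp hq, fun v hv => ?_⟩
    rw [Prod.fst_add, Prod.snd_add, form_add_right hv hp hq, inner_add_right, hp' v hv, hq' v hv]
  zero_mem' := by
    refine ⟨Submodule.zero_mem _, fun v _ => ?_⟩
    have h := form_smul_right (μ := μ) (df := df) (a := a) (0 : ℂ) v 0
    simpa using h
  smul_mem' := by
    rintro c p ⟨hp, hp'⟩
    refine ⟨Submodule.smul_mem _ c hp, fun v hv => ?_⟩
    rw [Prod.smul_fst, Prod.smul_snd, form_smul_right, inner_smul_right, hp' v hv]

/-- The fractional Dirichlet Laplacian `Δ_a`: the positive self-adjoint operator on `L²(X, μ)`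
associated with the closed form `E_a`. Its domain consists of all `u ∈ H_a` for which there is a
`w ∈ L²` with `E_a(v, u) = ⟪v, w⟫` for all `v ∈ H_a`, and then `Δ_a u = w` (which is unique as
soon as `H_a` is dense in `L²`). -/
def laplacian (μ : Measure X) [IsFiniteMeasure μ] (df a : ℝ) : Lp ℂ 2 μ →ₗ.[ℂ] Lp ℂ 2 μ :=
  (laplacianGraph μ df a).toLinearPMap

/-- The class in `L²(X, μ)` of a continuous function. -/
abbrev toL2 (μ : Measure X) [IsFiniteMeasure μ] (f : C(X, ℂ)) : Lp ℂ 2 μ :=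
  ContinuousMap.toLp (E := ℂ) 2 μ ℂ f

/-- Continuous functions of finite energy, `C(E_a) = H_a ∩ C(X)`. -/
def contSobolev (μ : Measure X) [IsFiniteMeasure μ] (df a : ℝ) : Set C(X, ℂ) :=
  {f | toL2 μ f ∈ sobolev ℂ μ df a}

theorem memLp_mul {μ : Measure X} [IsFiniteMeasure μ] (f : C(X, ℂ)) (u : Lp ℂ 2 μ) :
    MemLp (fun x => f x * u x) 2 μ :=
  (Lp.memLp u).of_le_mul (c := ‖f‖)
    (f.continuous.aestronglyMeasurable.mul (Lp.aestronglyMeasurable u))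
    (Eventually.of_forall fun x => by
      rw [norm_mul]
      gcongr
      exact f.norm_coe_le_norm x)

/-- The multiplication operator `m_f u = f u` on `L²(X, μ)`. -/
def mulOp (μ : Measure X) [IsFiniteMeasure μ] (f : C(X, ℂ)) (u : Lp ℂ 2 μ) : Lp ℂ 2 μ :=
  (memLp_mul f u).toLp _

/-- `m_f` preserves `Dom Δ_a`, and the bounded operator `T` extends
`[Δ_a, m_f] : Dom Δ_a → L²`. -/
def ExtendsCommutator (μ : Measure X) [IsFiniteMeasure μ] (df a : ℝ) (f : C(X, ℂ))
    (T : Lp ℂ 2 μ →L[ℂ] Lp ℂ 2 μ) : Prop :=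
  ∀ u : (laplacian μ df a).domain, ∃ h : mulOp μ f u ∈ (laplacian μ df a).domain,
    T u = laplacian μ df a ⟨mulOp μ f u, h⟩ - mulOp μ f (laplacian μ df a u)

end Form

/-! ### The Hilbert–Schmidt norm -/

section HilbertSchmidt

variable {H : Type*} [NormedAddCommGroup H] [InnerProductSpace ℂ H] [CompleteSpace H]

/-- The index set of a chosen orthonormal basis of `H`. -/
def basisIndex (H : Type*) [NormedAddCommGroup H] [InnerProductSpace ℂ H] [CompleteSpace H] :
    Set H :=
  (exists_hilbertBasis ℂ H).choose

/-- A chosen orthonormal basis of `H`. -/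
def chosenBasis (H : Type*) [NormedAddCommGroup H] [InnerProductSpace ℂ H] [CompleteSpace H] :
    HilbertBasis (basisIndex H) ℂ H :=
  (exists_hilbertBasis ℂ H).choose_spec.choose

/-- The Hilbert–Schmidt (Schatten `2`-) norm `(∑ ‖T e_i‖²)^(1/2) ∈ [0, ∞]`, where `(e_i)` is an
orthonormal basis; see `hsNorm_eq` for the independence of the basis. -/
def hsNorm (T : H →L[ℂ] H) : ℝ≥0∞ :=
  (∑' i, ‖T (chosenBasis H i)‖ₑ ^ 2) ^ (1 / 2 : ℝ)

theorem tsum_enorm_inner_sq {ι : Type*} (b : HilbertBasis ι ℂ H) (x : H) :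
    ∑' i, ‖⟪b i, x⟫_ℂ‖ₑ ^ 2 = ‖x‖ₑ ^ 2 := by
  have h := b.hasSum_inner_mul_inner x x
  have h1 : HasSum (fun i => ‖⟪b i, x⟫_ℂ‖ ^ 2) (‖x‖ ^ 2) := by
    have h2 := Complex.hasSum_re h
    convert h2 using 1
    · ext i
      rw [← inner_conj_symm x (b i), mul_comm, Complex.mul_conj, Complex.normSq_eq_norm_sq,
        Complex.ofReal_re]
    · rw [inner_self_eq_norm_sq_to_K]
      norm_cast
  have h3 : ∀ y : ℂ, ‖y‖ₑ ^ 2 = ENNReal.ofReal (‖y‖ ^ 2) := fun y => by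
    rw [← ofReal_norm, ENNReal.ofReal_pow (norm_nonneg _)]
  simp_rw [h3]
  rw [← ENNReal.ofReal_tsum_of_nonneg (fun _ => by positivity) h1.summable, h1.tsum_eq,
    ← ofReal_norm, ENNReal.ofReal_pow (norm_nonneg _)]

theorem tsum_enorm_sq_eq {ι κ : Type*} (b : HilbertBasis ι ℂ H) (c : HilbertBasis κ ℂ H)
    (T : H →L[ℂ] H) :
    ∑' i, ‖T (b i)‖ₑ ^ 2 = ∑' j, ‖ContinuousLinearMap.adjoint T (c j)‖ₑ ^ 2 := by
  have h1 : ∀ i, ‖T (b i)‖ₑ ^ 2 = ∑' j, ‖⟪c j, T (b i)⟫_ℂ‖ₑ ^ 2 := fun i =>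
    (tsum_enorm_inner_sq c _).symm
  have h2 : ∀ j, ‖ContinuousLinearMap.adjoint T (c j)‖ₑ ^ 2 =
      ∑' i, ‖⟪c j, T (b i)⟫_ℂ‖ₑ ^ 2 := fun j => by
    rw [← tsum_enorm_inner_sq b]
    refine tsum_congr fun i => ?_
    rw [ContinuousLinearMap.adjoint_inner_right, ← inner_conj_symm, ← ofReal_norm,
      RCLike.norm_conj, ofReal_norm]
  simp_rw [h1, h2]
  exact ENNReal.tsum_comm

theorem hsNorm_eq {ι : Type*} (b : HilbertBasis ι ℂ H) (T : H →L[ℂ] H) :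
    hsNorm T = (∑' i, ‖T (b i)‖ₑ ^ 2) ^ (1 / 2 : ℝ) := by
  rw [hsNorm, tsum_enorm_sq_eq _ b, tsum_enorm_sq_eq b b T]

end HilbertSchmidt

/-! ### The Monge–Kantorovich metric -/

section Metric

variable {X : Type*} [MetricSpace X] [MeasurableSpace X] [CompactSpace X] [BorelSpace X]

/-- The seminorm `L(f) = ‖cl [Δ_a, m_f]‖_{S₂}`, where `cl [Δ_a, m_f]` is the bounded extension of
the commutator to `L²(X, μ)`; it is `∞` if there is no bounded extension or if the extension is
not Hilbert–Schmidt. The infimum is over the (unique) bounded extension. -/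
def commutatorNorm (μ : Measure X) [IsFiniteMeasure μ] (df a : ℝ) (f : C(X, ℂ)) : ℝ≥0∞ :=
  ⨅ (T : Lp ℂ 2 μ →L[ℂ] Lp ℂ 2 μ) (_ : ExtendsCommutator μ df a f T), hsNorm T

/-- States of the C*-algebra `C(X)`: positive linear functionals of norm one. -/
def IsState {Y : Type*} [TopologicalSpace Y] [CompactSpace Y] (τ : C(Y, ℂ) →L[ℂ] ℂ) : Prop :=
  (∀ f : C(Y, ℂ), 0 ≤ τ (star f * f)) ∧ ‖τ‖ = 1

/-- The Monge–Kantorovich metric of the seminorm `‖cl [Δ_a, m_f]‖_{S₂}`, `f ∈ C(E_b)`, with values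
in `[0, ∞]`. -/
def mkMetric (μ : Measure X) [IsFiniteMeasure μ] (df a b : ℝ) (τ₁ τ₂ : C(X, ℂ) →L[ℂ] ℂ) : ℝ≥0∞ :=
  ⨆ (f : C(X, ℂ)) (_ : f ∈ contSobolev μ df b) (_ : commutatorNorm μ df a f ≤ 1), ‖τ₁ f - τ₂ f‖ₑ

/-- `ev 0 ≤ ev 1 ≤ …` are the eigenvalues of `Δ_b`, repeated according to multiplicity, and
`ef 0, ef 1, …` are continuous eigenfunctions for them that form an orthonormal basis of
`L²(X, μ)`. -/
structure IsEigenbasis (μ : Measure X) [IsFiniteMeasure μ] (df b : ℝ)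
    (ev : ℕ → ℝ) (ef : ℕ → C(X, ℂ)) : Prop where
  mono : Monotone ev
  orthonormal : Orthonormal ℂ (fun n => toL2 μ (ef n))
  dense_span : Dense (Submodule.span ℂ (Set.range fun n => toL2 μ (ef n)) : Set (Lp ℂ 2 μ))
  eigen : ∀ n, ∃ h : toL2 μ (ef n) ∈ (laplacian μ df b).domain,
    laplacian μ df b ⟨toL2 μ (ef n), h⟩ = (ev n : ℂ) • toL2 μ (ef n)

end Metric

end FracLap

end

/-! Formally `Δ_α` is the integral operator `u ↦ ∫ (u x - u y) / d(x,y)^(df + 2α) dμ(y)`, so `[Δ_α,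
m_f]` has kernel `(f x - f y) / d(x,y)^(df + 2α)`. The squared `L²` norm of this kernel has the
weight `d^(2 df + 4α) = d^(df + 2β)`: the squared Hilbert–Schmidt norm of the commutator is the
double integral `energy μ df β f`, that is, `2 E_β(f, f)`. The distance is therefore the dual norm
of `φ = τ₁ - τ₂` on the ball `2 E_β(f, f) ≤ 1`. Diagonalizing `E_β` by eigenfunctions of `Δ_β` turns
it into a weighted `ℓ²` norm, with the factor `1/2` coming from the `2`.

Three points make this rigorous. Since `β = df/2 + 2α`, a Morrey–Campanato argument
(`exists_holder_representative`) shows that functions in `H_β` are Hölder of order `2α`. This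
suffices for `m_f` to preserve `H_α` (`mulOp_mem_sobolev`), after which the kernel is identified
weakly, by symmetrizing the form (`form_mulOp_sub`, `commutatorNorm_eq`). The same embedding with
Arzelà–Ascoli makes the form domain compact in `L²` (`isCompactOperator_formIncl`), so the resolvent
has an eigenbasis with continuous eigenfunctions (`exists_isEigenbasis`). It also bounds the
oscillation of `f` by its energy: a functional that kills constants is bounded for the energy
seminorm (`exists_norm_apply_le_grad`), which gives finiteness and convergence of the series.

The walk dimension enters through density: `2β < d_w` is a rewriting of the bound on `α`, and a
regular form of higher order makes `H_β` dense in `L²` (`dense_sobolev_of_lt_walkDim`). -/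

noncomputable section

namespace FracLap

/-! ### Averages over sets and the energy -/

section Holder

variable {X : Type*} [MetricSpace X] [MeasurableSpace X]

theorem enorm_integral_sq_le {Ω : Type*} [MeasurableSpace Ω] (ν : Measure Ω) {h : Ω → ℂ}
    (hh : AEStronglyMeasurable h ν) :
    ‖∫ ω, h ω ∂ν‖ₑ ^ 2 ≤ ν Set.univ * ∫⁻ ω, ‖h ω‖ₑ ^ 2 ∂ν := by
  have h1 : ∫⁻ ω, ‖h ω‖ₑ ∂ν ≤
      (∫⁻ ω, ‖h ω‖ₑ ^ 2 ∂ν) ^ (1 / 2 : ℝ) * ν Set.univ ^ (1 / 2 : ℝ) := by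
    have := ENNReal.lintegral_mul_le_Lp_mul_Lq ν Real.HolderConjugate.two_two hh.enorm
      (aemeasurable_const (b := (1 : ℝ≥0∞)))
    simpa using this
  calc ‖∫ ω, h ω ∂ν‖ₑ ^ 2
      ≤ ((∫⁻ ω, ‖h ω‖ₑ ^ 2 ∂ν) ^ (1 / 2 : ℝ) * ν Set.univ ^ (1 / 2 : ℝ)) ^ 2 := by
        gcongr
        exact (enorm_integral_le_lintegral_enorm _).trans h1
    _ = ν Set.univ * ∫⁻ ω, ‖h ω‖ₑ ^ 2 ∂ν := by
        rw [mul_pow, mul_comm, ← ENNReal.rpow_natCast, ← ENNReal.rpow_natCast,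
          ← ENNReal.rpow_mul, ← ENNReal.rpow_mul]
        norm_num

theorem enorm_sub_sq_le_mul_div {t ρ : ℝ} (ht : 0 < t) (f : X → ℂ) {z w : X}
    (h : dist z w ≤ ρ) :
    ‖f z - f w‖ₑ ^ 2 ≤
      ENNReal.ofReal (ρ ^ t) * (‖f z - f w‖ₑ ^ 2 / ENNReal.ofReal (dist z w ^ t)) := by
  rcases eq_or_ne z w with rfl | hzw
  · simp
  have hd : 0 < dist z w ^ t := Real.rpow_pos_of_pos (dist_pos.2 hzw) _
  calc ‖f z - f w‖ₑ ^ 2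
      = ENNReal.ofReal (dist z w ^ t) * (‖f z - f w‖ₑ ^ 2 / ENNReal.ofReal (dist z w ^ t)) := by
        rw [ENNReal.mul_div_cancel (by simpa using hd) (by simp)]
    _ ≤ _ := by gcongr

theorem ofReal_rpow_le_measure_closedBall {μ : Measure X} {df C : ℝ}
    (hC : ∀ (x : X) (r : ℝ), 0 ≤ r → r < Metric.diam (Set.univ : Set X) →
      ENNReal.ofReal (C⁻¹ * r ^ df) ≤ μ (Metric.closedBall x r) ∧
        μ (Metric.closedBall x r) ≤ ENNReal.ofReal (C * r ^ df)) [IsFiniteMeasure μ]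
    {x : X} {r : ℝ} (hr : 0 ≤ r) (hrD : r < Metric.diam (Set.univ : Set X)) :
    C⁻¹ * r ^ df ≤ μ.real (Metric.closedBall x r) :=
  (ENNReal.ofReal_le_iff_le_toReal (measure_ne_top _ _)).1 (hC x r hr hrD).1

variable [CompactSpace X] [BorelSpace X]

/-- Full support makes `C(X) → L²` injective, so a continuous function of finite energy equals its
Hölder representative everywhere. -/
theorem IsAhlforsRegular.isOpenPosMeasure [Nontrivial X] {μ : Measure X} {df : ℝ}
    (hμ : IsAhlforsRegular μ df) : μ.IsOpenPosMeasure := by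
  obtain ⟨C, hC1, hC⟩ := hμ
  refine ⟨fun U hU hne h0 => ?_⟩
  obtain ⟨x, hx⟩ := hne
  obtain ⟨ε, hε, hεU⟩ := Metric.nhds_basis_closedBall.mem_iff.1 (hU.mem_nhds hx)
  have hD : 0 < Metric.diam (Set.univ : Set X) :=
    Metric.diam_pos Set.nontrivial_univ isCompact_univ.isBounded
  -- The regularity bounds are available only for radii below the diameter.
  set r := min ε (Metric.diam (Set.univ : Set X) / 2)
  have hr : 0 < r := lt_min hε (by linarith)
  have hrD : r < Metric.diam (Set.univ : Set X) := (min_le_right _ _).trans_lt (by linarith)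
  have h1 := (hC x r hr.le hrD).1
  have h2 : μ (Metric.closedBall x r) ≤ μ U :=
    measure_mono ((Metric.closedBall_subset_closedBall (min_le_left _ _)).trans hεU)
  rw [h0] at h2
  have h3 := h1.trans h2
  simp only [nonpos_iff_eq_zero, ENNReal.ofReal_eq_zero] at h3
  have : 0 < C⁻¹ * r ^ df := by positivity
  linarith

variable {μ : Measure X} [IsFiniteMeasure μ]

/-- Averages of `f` over two close sets of positive measure differ by at most the energy. -/
theorem norm_average_sub_average_sq_le {df a ρ : ℝ} (ht : 0 < df + 2 * a) {f : X → ℂ}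
    (hf : Integrable f μ) (hE : energy μ df a f < ∞) {A B : Set X}
    (hA : MeasurableSet A) (hB : MeasurableSet B) (hA0 : 0 < μ.real A) (hB0 : 0 < μ.real B)
    (hρ : ∀ z ∈ A, ∀ w ∈ B, dist z w ≤ ρ) (hρ0 : 0 ≤ ρ) :
    ‖(⨍ x in A, f x ∂μ) - ⨍ x in B, f x ∂μ‖ ^ 2 ≤
      ρ ^ (df + 2 * a) * (energy μ df a f).toReal / (μ.real A * μ.real B) := by
  set ν := (μ.restrict A).prod (μ.restrict B) with hν
  have hν' : ν = (μ.prod μ).restrict (A ×ˢ B) := Measure.prod_restrict A B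
  have hfA : Integrable (fun p : X × X => f p.1) ν := hf.restrict.comp_fst _
  have hfB : Integrable (fun p : X × X => f p.2) ν := hf.restrict.comp_snd _
  have h1 := enorm_integral_sq_le ν (hfA.sub hfB).aestronglyMeasurable
  -- The difference of the averages is the mean of `f z - f w` over `A ×ˢ B`, so Cauchy–Schwarz on
  -- this product applies; there the weight is at most `ρ ^ (df + 2 * a)`.
  have h2 : ∫ p, ((fun p : X × X => f p.1) - fun p : X × X => f p.2) p ∂ν =
      (μ.real A * μ.real B) • ((⨍ x in A, f x ∂μ) - ⨍ x in B, f x ∂μ) := by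
    simp only [Pi.sub_apply]
    rw [integral_sub hfA hfB, hν, integral_fun_fst, integral_fun_snd, setAverage_eq, setAverage_eq]
    simp only [measureReal_restrict_apply_univ, smul_sub, smul_smul]
    congr 2 <;> field_simp
  have h3 : ∫⁻ p, ‖((fun p : X × X => f p.1) - fun p : X × X => f p.2) p‖ₑ ^ 2 ∂ν ≤
      ENNReal.ofReal (ρ ^ (df + 2 * a)) * energy μ df a f := by
    unfold energy
    rw [← lintegral_const_mul' _ _ (by simp)]
    refine le_trans ?_ (lintegral_mono' (Measure.restrict_le_self (s := A ×ˢ B)) le_rfl)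
    rw [hν']
    refine setLIntegral_mono' (hA.prod hB) fun p hp => ?_
    exact enorm_sub_sq_le_mul_div ht f (hρ _ hp.1 _ hp.2)
  have h4 : ν Set.univ = μ A * μ B := by
    rw [hν', Measure.restrict_apply_univ, Measure.prod_prod]
  rw [h2, h4] at h1
  have h5 := h1.trans (mul_le_mul_right h3 _)
  have h6 := ENNReal.toReal_mono (by finiteness) h5
  simp only [ENNReal.toReal_mul, ENNReal.toReal_pow, toReal_enorm] at h6
  rw [norm_smul, ENNReal.toReal_ofReal (by positivity)] at h6
  change (_ * _) ^ 2 ≤ μ.real A * μ.real B * _ at h6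
  rw [Real.norm_of_nonneg (by positivity)] at h6
  rw [le_div_iff₀ (by positivity)]
  have hm : 0 < μ.real A * μ.real B := by positivity
  refine le_of_mul_le_mul_left ?_ hm
  calc _ = (μ.real A * μ.real B *
      ‖(⨍ x in A, f x ∂μ) - ⨍ x in B, f x ∂μ‖) ^ 2 := by ring
    _ ≤ _ := h6

/-- The average of `f` over a small set near `x` differs from `f x` by at most the local energy. -/
theorem norm_sub_average_sq_le {t ρ : ℝ} (ht : 0 < t) {f : X → ℂ}
    (hf : Integrable f μ) {B : Set X} (hB : MeasurableSet B) (hB0 : 0 < μ.real B) {x : X}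
    (hE : ∫⁻ y, ‖f x - f y‖ₑ ^ 2 / ENNReal.ofReal (dist x y ^ t) ∂μ < ∞)
    (hρ : ∀ w ∈ B, dist x w ≤ ρ) (hρ0 : 0 ≤ ρ) :
    ‖f x - ⨍ x in B, f x ∂μ‖ ^ 2 ≤ ρ ^ t *
      (∫⁻ y, ‖f x - f y‖ₑ ^ 2 / ENNReal.ofReal (dist x y ^ t) ∂μ).toReal / μ.real B := by
  have hc : Integrable (fun _ : X => f x) (μ.restrict B) := integrable_const _
  have h1 := enorm_integral_sq_le (μ.restrict B) (hc.sub hf.restrict).aestronglyMeasurable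
  have h2 : ∫ y in B, ((fun _ : X => f x) - f) y ∂μ =
      μ.real B • (f x - ⨍ x in B, f x ∂μ) := by
    simp only [Pi.sub_apply]
    rw [integral_sub hc hf.restrict, setAverage_eq]
    simp only [setIntegral_const, smul_sub, smul_smul]
    congr 1
    rw [mul_inv_cancel₀ hB0.ne', one_smul]
  have h3 : ∫⁻ y in B, ‖((fun _ : X => f x) - f) y‖ₑ ^ 2 ∂μ ≤ ENNReal.ofReal (ρ ^ t) *
      ∫⁻ y, ‖f x - f y‖ₑ ^ 2 / ENNReal.ofReal (dist x y ^ t) ∂μ := by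
    rw [← lintegral_const_mul' _ _ (by simp)]
    refine le_trans ?_ (lintegral_mono' (Measure.restrict_le_self (s := B)) le_rfl)
    exact setLIntegral_mono' hB fun y hy => enorm_sub_sq_le_mul_div ht f (hρ _ hy)
  rw [h2, Measure.restrict_apply_univ] at h1
  have h5 := h1.trans (mul_le_mul_right h3 _)
  have h6 := ENNReal.toReal_mono (by finiteness) h5
  simp only [ENNReal.toReal_mul, ENNReal.toReal_pow, toReal_enorm] at h6
  rw [norm_smul, ENNReal.toReal_ofReal (by positivity)] at h6
  change (_ * _) ^ 2 ≤ μ.real B * _ at h6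
  rw [Real.norm_of_nonneg (by positivity)] at h6
  rw [le_div_iff₀ (by positivity)]
  refine le_of_mul_le_mul_left ?_ hB0
  calc _ = (μ.real B * ‖f x - ⨍ x in B, f x ∂μ‖) ^ 2 := by ring
    _ ≤ _ := h6

end Holder

/-! ### Hölder representatives (Morrey–Campanato embedding) -/

section Holder

variable {X : Type*} [MetricSpace X] [MeasurableSpace X] [CompactSpace X] [BorelSpace X]
  {μ : Measure X} [IsFiniteMeasure μ]

theorem aemeasurable_energy_integrand (t : ℝ) (f : Lp ℂ 2 μ) :
    AEMeasurable (fun p : X × X => ‖f p.1 - f p.2‖ₑ ^ 2 / ENNReal.ofReal (dist p.1 p.2 ^ t))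
      (μ.prod μ) :=
  ((aestronglyMeasurable_diff f).enorm.pow_const 2).div (aemeasurable_weight μ t)

/-- Points of the two balls are within `4 * r`, and both balls have mass at least a multiple of `r ^
df`, so the squared difference is of order `r ^ (2 * df + 2 * s) / r ^ (2 * df)` times the energy.
The range allowed for `r'` covers both uses: halving the radius at one centre, and changing the
centre at fixed radius. -/
theorem norm_average_closedBall_sub_le {df s C : ℝ} (hdf : 0 < df) (hs : 0 < s) (hC1 : 1 ≤ C)
    (hC : ∀ (x : X) (r : ℝ), 0 ≤ r → r < Metric.diam (Set.univ : Set X) →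
      ENNReal.ofReal (C⁻¹ * r ^ df) ≤ μ (Metric.closedBall x r) ∧
        μ (Metric.closedBall x r) ≤ ENNReal.ofReal (C * r ^ df))
    {f : X → ℂ} (hf : Integrable f μ) (hE : energy μ df (df / 2 + s) f < ∞) {x y : X} {r r' : ℝ}
    (hr : 0 < r) (hrD : r < Metric.diam (Set.univ : Set X)) (hr' : r / 2 ≤ r') (hrr' : r' ≤ r)
    (hxy : dist x y ≤ 2 * r) :
    ‖(⨍ z in Metric.closedBall x r, f z ∂μ) - ⨍ z in Metric.closedBall y r', f z ∂μ‖ ≤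
      √(C ^ 2 * 4 ^ (2 * df + 2 * s) * 2 ^ df) * √(energy μ df (df / 2 + s) f).toReal * r ^ s := by
  have hC0 : 0 < C := by linarith
  have hA := ofReal_rpow_le_measure_closedBall hC (x := x) hr.le hrD
  have hB : C⁻¹ * (r / 2) ^ df ≤ μ.real (Metric.closedBall y r') :=
    (ofReal_rpow_le_measure_closedBall hC (x := y) (by linarith)
      (by linarith : r / 2 < _)).trans
      (measureReal_mono (Metric.closedBall_subset_closedBall hr'))
  have hA0 : 0 < C⁻¹ * r ^ df := by positivity
  have hB0 : 0 < C⁻¹ * (r / 2) ^ df := by positivity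
  have h := norm_average_sub_average_sq_le (a := df / 2 + s) (ρ := 4 * r) (by linarith) hf hE
    (Metric.isClosed_closedBall (x := x) (ε := r)).measurableSet
    (Metric.isClosed_closedBall (x := y) (ε := r')).measurableSet
    (hA0.trans_le hA) (hB0.trans_le hB) (fun z hz w hw => by
      have h1 := dist_triangle4 z x y w
      rw [Metric.mem_closedBall] at hz
      rw [Metric.mem_closedBall, dist_comm] at hw
      linarith) (by linarith)
  refine abs_le_of_sq_le_sq' ?_ (by positivity) |>.2
  refine h.trans ?_
  rw [mul_pow, mul_pow, Real.sq_sqrt (by positivity), Real.sq_sqrt (by positivity)]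
  calc _ ≤ (4 * r) ^ (df + 2 * (df / 2 + s)) * (energy μ df (df / 2 + s) f).toReal /
        (C⁻¹ * r ^ df * (C⁻¹ * (r / 2) ^ df)) := by gcongr
    _ = _ := by
      rw [show df + 2 * (df / 2 + s) = 2 * df + 2 * s by ring,
        Real.mul_rpow (by norm_num) hr.le, Real.div_rpow hr.le (by norm_num),
        show 2 * df + 2 * s = df + df + s + s by ring, Real.rpow_add hr, Real.rpow_add hr,
        Real.rpow_add hr]
      have : 0 < r ^ df := by positivity
      field_simp

/-- Every function of finite energy of order `df / 2 + s` is Hölder continuous of order `s`. -/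
theorem exists_holder_representative [Nontrivial X] {df s : ℝ} (hdf : 0 < df) (hs : 0 < s)
    (hμ : IsAhlforsRegular μ df) :
    ∃ K : ℝ, 0 ≤ K ∧ ∀ f : Lp ℂ 2 μ, energy μ df (df / 2 + s) f < ∞ →
      ∃ g : C(X, ℂ), toL2 μ g = f ∧ ∀ x y, ‖g x - g y‖ ≤
        K * √(energy μ df (df / 2 + s) f).toReal * dist x y ^ s := by
  obtain ⟨C, hC1, hC⟩ := hμ
  have hC0 : 0 < C := by linarith
  set D := Metric.diam (Set.univ : Set X) with hDdef
  have hD : 0 < D := Metric.diam_pos Set.nontrivial_univ isCompact_univ.isBounded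
  set M := √(C ^ 2 * 4 ^ (2 * df + 2 * s) * 2 ^ df) with hM
  set q : ℝ := (1 / 2) ^ s with hq
  have hq0 : 0 < q := by positivity
  have hq1 : q < 1 := Real.rpow_lt_one (by norm_num) (by norm_num) hs
  have h1q : 0 < 1 - q := by linarith
  refine ⟨M * (1 + 2 / (1 - q)), by positivity, fun f hE => ?_⟩
  set E := √(energy μ df (df / 2 + s) f).toReal with hEdef
  have hfi : Integrable f μ := (Lp.memLp f).integrable (by norm_num)
  -- Starting at `D / 2` keeps every `r n` below `D`, while `2 * r 0 = D` still bounds all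
  -- distances.
  set r : ℕ → ℝ := fun n => D / 2 * (1 / 2) ^ n with hr
  have hr0 : ∀ n, 0 < r n := fun n => by positivity
  have hrs : ∀ n, r (n + 1) = r n / 2 := fun n => by simp only [hr, pow_succ]; ring
  have hrD : ∀ n, r n < D := fun n => by
    have : (1 / 2 : ℝ) ^ n ≤ 1 := pow_le_one₀ (by norm_num) (by norm_num)
    simp only [hr]
    nlinarith
  have hrq : ∀ n, r n ^ s = (D / 2) ^ s * q ^ n := fun n => by
    simp only [hr]
    rw [Real.mul_rpow (by positivity) (by positivity), ← Real.rpow_natCast, ← Real.rpow_mul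
      (by norm_num), mul_comm (n : ℝ), Real.rpow_mul (by norm_num), Real.rpow_natCast]
  set A : X → ℕ → ℂ := fun x n => ⨍ z in Metric.closedBall x (r n), f z ∂μ with hA
  have hA1 : ∀ x n, dist (A x n) (A x (n + 1)) ≤ (M * E * (D / 2) ^ s) * q ^ n := fun x n => by
    rw [dist_eq_norm]
    refine (norm_average_closedBall_sub_le hdf hs hC1 hC hfi hE (hr0 n) (hrD n) (hrs n).ge
      (by rw [hrs]; linarith [hr0 n]) (by simp [(hr0 n).le])).trans (le_of_eq ?_)
    rw [hrq]
    ring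
  have hA2 : ∀ x y n, dist x y ≤ 2 * r n → dist (A x n) (A y n) ≤ M * E * r n ^ s :=
      fun x y n h => by
    rw [dist_eq_norm]
    exact norm_average_closedBall_sub_le hdf hs hC1 hC hfi hE (hr0 n) (hrD n)
      (by linarith [hr0 n]) le_rfl h
  -- The averages over shrinking balls converge geometrically at every point; their limit is the
  -- representative.
  choose g hg using fun x => cauchySeq_tendsto_of_complete
    (cauchySeq_of_le_geometric q _ hq1 (hA1 x))
  have hA3 : ∀ x n, dist (A x n) (g x) ≤ M * E * r n ^ s / (1 - q) := fun x n => by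
    refine (dist_le_of_le_geometric_of_tendsto q _ hq1 (hA1 x) (hg x) n).trans (le_of_eq ?_)
    rw [hrq]
    ring
  have hrlim : Tendsto r atTop (𝓝 0) := by
    have := (tendsto_pow_atTop_nhds_zero_of_lt_one (r := (1 / 2 : ℝ)) (by norm_num)
      (by norm_num)).const_mul (D / 2)
    simpa [hr, one_div] using this
  have hhol : ∀ x y, ‖g x - g y‖ ≤ M * (1 + 2 / (1 - q)) * E * dist x y ^ s := fun x y => by
    rcases eq_or_ne x y with rfl | hxy
    · simp [Real.zero_rpow hs.ne']
    have hd : 0 < dist x y := dist_pos.2 hxy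
    -- The averages are compared at the dyadic scale of `dist x y`, the first `n` with `r n < dist x
    -- y`.
    obtain ⟨n, hn1, hn2⟩ : ∃ n, dist x y ≤ 2 * r n ∧ r n < dist x y := by
      have hex : ∃ n, r n < dist x y := ((tendsto_order.1 hrlim).2 _ hd).exists
      classical
      refine ⟨Nat.find hex, ?_, Nat.find_spec hex⟩
      rcases h0 : Nat.find hex with _ | m
      · have : dist x y ≤ D := Metric.dist_le_diam_of_mem isCompact_univ.isBounded
          (Set.mem_univ _) (Set.mem_univ _)
        simp only [hr]
        linarith
      · rw [hrs]
        have := Nat.find_min hex (m := m) (by omega)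
        linarith
    rw [← dist_eq_norm]
    calc dist (g x) (g y) ≤ dist (g x) (A x n) + dist (A x n) (A y n) + dist (A y n) (g y) :=
          dist_triangle4 _ _ _ _
      _ ≤ M * E * r n ^ s / (1 - q) + M * E * r n ^ s + M * E * r n ^ s / (1 - q) := by
          rw [dist_comm (g x)]
          exact add_le_add (add_le_add (hA3 x n) (hA2 x y n hn1)) (hA3 y n)
      _ = M * (1 + 2 / (1 - q)) * E * r n ^ s := by ring
      _ ≤ _ := by
          have := hr0 n
          gcongr
  have hcont : Continuous g := by
    rw [Metric.continuous_iff']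
    intro x ε hε
    have h0 : Tendsto (fun y => M * (1 + 2 / (1 - q)) * E * dist y x ^ s) (𝓝 x) (𝓝 0) := by
      have h1 : Tendsto (fun y => dist y x ^ s) (𝓝 x) (𝓝 0) := by
        have := (tendsto_iff_dist_tendsto_zero.1 (tendsto_id (x := 𝓝 x))).rpow_const
          (Or.inr hs.le)
        simpa [Real.zero_rpow hs.ne'] using this
      simpa using h1.const_mul (M * (1 + 2 / (1 - q)) * E)
    filter_upwards [(tendsto_order.1 h0).2 ε hε] with y hy
    rw [dist_eq_norm]
    exact (hhol y x).trans_lt hy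
  refine ⟨⟨g, hcont⟩, ?_, hhol⟩
  refine Lp.ext ((ContinuousMap.coeFn_toLp (𝕜 := ℂ) μ _).trans ?_)
  have ht : 0 < df + 2 * (df / 2 + s) := by linarith
  -- By Fubini the energy localized at `x` is finite for almost every `x`. At such points the
  -- averages converge to `f x` at rate `r n ^ (df / 2 + s)`, and no differentiation theorem is
  -- needed.
  have hloc : ∀ᵐ x ∂μ, ∫⁻ y, ‖f x - f y‖ₑ ^ 2 /
      ENNReal.ofReal (dist x y ^ (df + 2 * (df / 2 + s))) ∂μ < ∞ := by
    have hm := aemeasurable_energy_integrand (μ := μ) (df + 2 * (df / 2 + s)) f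
    unfold energy at hE
    rw [lintegral_prod _ hm] at hE
    exact ae_lt_top' hm.lintegral_prod_right' hE.ne
  filter_upwards [hloc] with x hx
  refine tendsto_nhds_unique (hg x) ?_
  rw [tendsto_iff_norm_sub_tendsto_zero]
  set e := (∫⁻ y, ‖f x - f y‖ₑ ^ 2 /
      ENNReal.ofReal (dist x y ^ (df + 2 * (df / 2 + s))) ∂μ).toReal with he
  have hb : ∀ n, ‖A x n - f x‖ ≤ √(C * e) * r n ^ (df / 2 + s) := fun n => by
    have hball := ofReal_rpow_le_measure_closedBall hC (x := x) (hr0 n).le (hrD n)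
    have hpos : 0 < C⁻¹ * r n ^ df := by have := hr0 n; positivity
    have h1 := norm_sub_average_sq_le (ρ := r n) ht hfi
      (Metric.isClosed_closedBall (x := x) (ε := r n)).measurableSet (hpos.trans_le hball) hx
      (fun w hw => by rwa [Metric.mem_closedBall, dist_comm] at hw) (hr0 n).le
    have hrn := hr0 n
    refine abs_le_of_sq_le_sq' ?_ (by positivity) |>.2
    rw [norm_sub_rev]
    refine h1.trans ?_
    rw [mul_pow, Real.sq_sqrt (by positivity)]
    calc _ ≤ r n ^ (df + 2 * (df / 2 + s)) * e / (C⁻¹ * r n ^ df) := by gcongr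
      _ = _ := by
        rw [Real.rpow_add hrn, ← Real.rpow_natCast (r n ^ (df / 2 + s)), ← Real.rpow_mul hrn.le]
        have : 0 < r n ^ df := by positivity
        push_cast
        rw [mul_comm (2 : ℝ)]
        field_simp
  refine squeeze_zero (fun _ => norm_nonneg _) hb ?_
  have h2 := (hrlim.rpow_const (p := df / 2 + s) (Or.inr (by positivity))).const_mul √(C * e)
  simpa [Real.zero_rpow (by positivity : df / 2 + s ≠ 0)] using h2

end Holder

/-! ### Closedness of the form, the resolvent and the Laplacian -/

section FormDomain

variable {X : Type*} [MetricSpace X] [MeasurableSpace X]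

/-- The normalized difference quotient, whose `L²` inner products are the values of the form. -/
def diffQuot (df a : ℝ) (f : X → ℂ) (p : X × X) : ℂ :=
  (f p.1 - f p.2) / (√(2 * dist p.1 p.2 ^ (df + 2 * a)) : ℝ)

theorem enorm_diffQuot_sq (df a : ℝ) (f : X → ℂ) (p : X × X) :
    ‖diffQuot df a f p‖ₑ ^ 2 =
      2⁻¹ * (‖f p.1 - f p.2‖ₑ ^ 2 / ENNReal.ofReal (dist p.1 p.2 ^ (df + 2 * a))) := by
  rcases eq_or_ne p.1 p.2 with h | h
  · simp [diffQuot, h]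
  have hd : 0 < dist p.1 p.2 ^ (df + 2 * a) := Real.rpow_pos_of_pos (dist_pos.2 h) _
  rw [← ofReal_norm, ← ofReal_norm, ← ENNReal.ofReal_pow (norm_nonneg _),
    ← ENNReal.ofReal_pow (norm_nonneg _), ← ENNReal.ofReal_div_of_pos hd,
    show (2⁻¹ : ℝ≥0∞) = ENNReal.ofReal 2⁻¹ by
      rw [ENNReal.ofReal_inv_of_pos (by norm_num), ENNReal.ofReal_ofNat],
    ← ENNReal.ofReal_mul (by norm_num)]
  congr 1
  rw [diffQuot, norm_div, Complex.norm_real, Real.norm_of_nonneg (Real.sqrt_nonneg _), div_pow,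
    Real.sq_sqrt (by positivity)]
  field_simp

theorem conj_diffQuot_mul (df a : ℝ) (f g : X → ℂ) (p : X × X) :
    (starRingEnd ℂ) (diffQuot df a f p) * diffQuot df a g p =
      (1 / 2 : ℂ) * ((starRingEnd ℂ) (f p.1 - f p.2) * (g p.1 - g p.2) /
        ((dist p.1 p.2 ^ (df + 2 * a) : ℝ) : ℂ)) := by
  rw [diffQuot, diffQuot, map_div₀, Complex.conj_ofReal, div_mul_div_comm, ← Complex.ofReal_mul,
    Real.mul_self_sqrt (by positivity)]
  push_cast
  rw [mul_comm (2 : ℂ), ← div_div]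
  ring

theorem energy_eq_lintegral_diffQuot (μ : Measure X) (df a : ℝ) (f : X → ℂ) :
    energy μ df a f = 2 * ∫⁻ p, ‖diffQuot df a f p‖ₑ ^ 2 ∂(μ.prod μ) := by
  simp_rw [enorm_diffQuot_sq]
  rw [lintegral_const_mul' _ _ (by simp), ← mul_assoc, ENNReal.mul_inv_cancel (by simp) (by simp),
    one_mul, energy]

variable [CompactSpace X] [BorelSpace X]

theorem aestronglyMeasurable_diffQuot {μ : Measure X} [SFinite μ] (df a : ℝ) (f : Lp ℂ 2 μ) :
    AEStronglyMeasurable (diffQuot df a f) (μ.prod μ) := by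
  have hw : Measurable (fun p : X × X => ((√(2 * dist p.1 p.2 ^ (df + 2 * a)) : ℝ) : ℂ)) := by
    have : Measurable (fun p : X × X => dist p.1 p.2) := continuous_dist.measurable
    exact Complex.measurable_ofReal.comp ((this.pow_const _).const_mul 2).sqrt
  exact ((aestronglyMeasurable_diff f).aemeasurable.div hw.aemeasurable).aestronglyMeasurable

variable {μ : Measure X} [IsFiniteMeasure μ] {df a : ℝ}

theorem memLp_diffQuot_iff {f : Lp ℂ 2 μ} :
    MemLp (diffQuot df a f) 2 (μ.prod μ) ↔ f ∈ sobolev ℂ μ df a := by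
  rw [MemLp, and_iff_right (aestronglyMeasurable_diffQuot df a f),
    eLpNorm_lt_top_iff_lintegral_rpow_enorm_lt_top (by simp) (by simp)]
  change _ ↔ energy μ df a f < ∞
  rw [energy_eq_lintegral_diffQuot]
  simp [lt_top_iff_ne_top, ENNReal.mul_eq_top]

theorem diffQuot_congr {f g : X → ℂ} (h : f =ᵐ[μ] g) :
    diffQuot df a f =ᵐ[μ.prod μ] diffQuot df a g := by
  filter_upwards [Measure.quasiMeasurePreserving_fst.ae h,
    Measure.quasiMeasurePreserving_snd.ae h] with p h1 h2
  rw [diffQuot, diffQuot, h1, h2]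

/-- The domain of the form, as the graph of the difference quotient. -/
def formGraph (μ : Measure X) [IsFiniteMeasure μ] (df a : ℝ) :
    Submodule ℂ (WithLp 2 (Lp ℂ 2 μ × Lp ℂ 2 (μ.prod μ))) where
  carrier := {z | z.snd =ᵐ[μ.prod μ] diffQuot df a z.fst}
  add_mem' := by
    intro z w hz hw
    change ⇑(z.snd + w.snd) =ᵐ[μ.prod μ] diffQuot df a ⇑(z.fst + w.fst)
    refine (Lp.coeFn_add _ _).trans (EventuallyEq.trans ?_
      (diffQuot_congr (Lp.coeFn_add z.fst w.fst)).symm)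
    filter_upwards [hz, hw] with p h1 h2
    simp only [Pi.add_apply, h1, h2, diffQuot]
    ring
  zero_mem' := by
    change ⇑(0 : Lp ℂ 2 (μ.prod μ)) =ᵐ[μ.prod μ] diffQuot df a ⇑(0 : Lp ℂ 2 μ)
    refine (Lp.coeFn_zero _ _ _).trans (EventuallyEq.trans ?_
      (diffQuot_congr (Lp.coeFn_zero _ _ _)).symm)
    exact Eventually.of_forall fun p => by simp [diffQuot]
  smul_mem' := by
    intro c z hz
    change ⇑(c • z.snd) =ᵐ[μ.prod μ] diffQuot df a ⇑(c • z.fst)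
    refine (Lp.coeFn_smul _ _).trans (EventuallyEq.trans ?_
      (diffQuot_congr (Lp.coeFn_smul c z.fst)).symm)
    filter_upwards [hz] with p h1
    simp only [Pi.smul_apply, h1, diffQuot, smul_eq_mul]
    ring

theorem mem_formGraph {z : WithLp 2 (Lp ℂ 2 μ × Lp ℂ 2 (μ.prod μ))} :
    z ∈ formGraph μ df a ↔ z.snd =ᵐ[μ.prod μ] diffQuot df a z.fst := Iff.rfl

theorem fst_mem_sobolev {z : WithLp 2 (Lp ℂ 2 μ × Lp ℂ 2 (μ.prod μ))}
    (hz : z ∈ formGraph μ df a) : z.fst ∈ sobolev ℂ μ df a :=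
  memLp_diffQuot_iff.1 ((memLp_congr_ae hz).1 (Lp.memLp z.snd))

theorem exists_mem_formGraph {f : Lp ℂ 2 μ} (hf : f ∈ sobolev ℂ μ df a) :
    ∃ z ∈ formGraph μ df a, z.fst = f :=
  ⟨WithLp.toLp 2 (f, (memLp_diffQuot_iff.2 hf).toLp _),
    MemLp.coeFn_toLp (memLp_diffQuot_iff.2 hf), rfl⟩

theorem inner_snd_eq_form {z w : WithLp 2 (Lp ℂ 2 μ × Lp ℂ 2 (μ.prod μ))}
    (hz : z ∈ formGraph μ df a) (hw : w ∈ formGraph μ df a) :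
    ⟪z.snd, w.snd⟫_ℂ = form μ df a z.fst w.fst := by
  rw [L2.inner_def, form, ← integral_const_mul]
  refine integral_congr_ae ?_
  filter_upwards [hz, hw] with p h1 h2
  rw [h1, h2, RCLike.inner_apply, mul_comm, conj_diffQuot_mul]
  rfl

theorem inner_eq_inner_add_form {z w : WithLp 2 (Lp ℂ 2 μ × Lp ℂ 2 (μ.prod μ))}
    (hz : z ∈ formGraph μ df a) (hw : w ∈ formGraph μ df a) :
    ⟪z, w⟫_ℂ = ⟪z.fst, w.fst⟫_ℂ + form μ df a z.fst w.fst := by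
  rw [← inner_snd_eq_form hz hw, WithLp.prod_inner_apply]
  rfl

/-- This is the closedness of the form. Along a common subsequence both `L²` components converge
almost everywhere, and the difference quotient passes to the pointwise limit. -/
theorem isClosed_formGraph :
    IsClosed (formGraph μ df a : Set (WithLp 2 (Lp ℂ 2 μ × Lp ℂ 2 (μ.prod μ)))) := by
  refine IsSeqClosed.isClosed fun u z hu hz => ?_
  have h1 : Tendsto (fun n => (u n).fst) atTop (𝓝 z.fst) :=
    ((WithLp.fstL 2 ℂ (Lp ℂ 2 μ) (Lp ℂ 2 (μ.prod μ))).continuous.tendsto z).comp hz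
  have h2 : Tendsto (fun n => (u n).snd) atTop (𝓝 z.snd) :=
    ((WithLp.sndL 2 ℂ (Lp ℂ 2 μ) (Lp ℂ 2 (μ.prod μ))).continuous.tendsto z).comp hz
  obtain ⟨φ, hφ, hφ'⟩ := (tendstoInMeasure_of_tendsto_Lp h1).exists_seq_tendsto_ae
  obtain ⟨ψ, hψ, hψ'⟩ := (tendstoInMeasure_of_tendsto_Lp
    (h2.comp hφ.tendsto_atTop)).exists_seq_tendsto_ae
  have h3 : ∀ᵐ p ∂(μ.prod μ), ∀ n, (u n).snd p = diffQuot df a (u n).fst p :=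
    ae_all_iff.2 fun n => hu n
  filter_upwards [Measure.quasiMeasurePreserving_fst.ae hφ',
    Measure.quasiMeasurePreserving_snd.ae hφ', hψ', h3] with p h4 h5 h6 h7
  refine tendsto_nhds_unique h6 ?_
  simp only [Function.comp_apply, h7]
  exact ((h4.comp hψ.tendsto_atTop).sub (h5.comp hψ.tendsto_atTop)).div_const _

instance : CompleteSpace (formGraph μ df a) := isClosed_formGraph.completeSpace_coe

/-- The inclusion of the form domain, with the form norm, into `L²`. -/
def formIncl (μ : Measure X) [IsFiniteMeasure μ] (df a : ℝ) : formGraph μ df a →L[ℂ] Lp ℂ 2 μ :=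
  (WithLp.fstL 2 ℂ (Lp ℂ 2 μ) (Lp ℂ 2 (μ.prod μ))).comp (formGraph μ df a).subtypeL

theorem formIncl_apply (z : formGraph μ df a) : formIncl μ df a z = z.1.fst := rfl

/-- The resolvent `(1 + Δ_a)⁻¹`. -/
def resolvent (μ : Measure X) [IsFiniteMeasure μ] (df a : ℝ) : Lp ℂ 2 μ →L[ℂ] Lp ℂ 2 μ :=
  (formIncl μ df a).comp (ContinuousLinearMap.adjoint (formIncl μ df a))

theorem mem_laplacianGraph_iff {u w : Lp ℂ 2 μ} :
    (u, w) ∈ laplacianGraph μ df a ↔ u ∈ sobolev ℂ μ df a ∧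
      ∀ v ∈ sobolev ℂ μ df a, form μ df a v u = ⟪v, w⟫_ℂ := Iff.rfl

/-- Let `J` be the inclusion of the form domain, so that the resolvent is `J J*`. The adjoint
relation reads `⟪v, J J* u⟫ + E_a(v, J J* u) = ⟪v, u⟫`; moving the first term to the right gives the
weak equation. -/
theorem resolvent_mem_laplacianGraph (u : Lp ℂ 2 μ) :
    (resolvent μ df a u, u - resolvent μ df a u) ∈ laplacianGraph μ df a := by
  set w := ContinuousLinearMap.adjoint (formIncl μ df a) u with hw
  have hr : resolvent μ df a u = w.1.fst := rfl
  rw [mem_laplacianGraph_iff, hr]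
  refine ⟨fst_mem_sobolev w.2, fun v hv => ?_⟩
  obtain ⟨z, hz, rfl⟩ := exists_mem_formGraph hv
  have h := ContinuousLinearMap.adjoint_inner_right (formIncl μ df a) ⟨z, hz⟩ u
  rw [← hw, Submodule.coe_inner, inner_eq_inner_add_form hz w.2, formIncl_apply] at h
  rw [inner_sub_right, ← h]
  ring

theorem isSelfAdjoint_resolvent : IsSelfAdjoint (resolvent μ df a) := by
  rw [ContinuousLinearMap.isSelfAdjoint_iff', resolvent, ContinuousLinearMap.adjoint_comp,
    ContinuousLinearMap.adjoint_adjoint]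

/-- Density of `H_a` makes the graph single-valued; without it `toLinearPMap` need not have the
prescribed graph. -/
theorem snd_eq_zero_of_mem_laplacianGraph (hd : Dense (sobolev ℂ μ df a : Set (Lp ℂ 2 μ)))
    {w : Lp ℂ 2 μ} (h : ((0 : Lp ℂ 2 μ), w) ∈ laplacianGraph μ df a) : w = 0 := by
  rw [mem_laplacianGraph_iff] at h
  refine hd.eq_zero_of_inner_right ℂ fun v hv => ?_
  rw [← h.2 v hv]
  have := form_smul_right (μ := μ) (df := df) (a := a) (0 : ℂ) v 0
  simpa using this

theorem resolvent_injective (hd : Dense (sobolev ℂ μ df a : Set (Lp ℂ 2 μ))) :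
    Function.Injective (resolvent μ df a) := by
  rw [injective_iff_map_eq_zero]
  intro u hu
  have h := resolvent_mem_laplacianGraph (μ := μ) (df := df) (a := a) u
  rw [hu, sub_zero] at h
  exact snd_eq_zero_of_mem_laplacianGraph hd h

theorem graph_laplacian (hd : Dense (sobolev ℂ μ df a : Set (Lp ℂ 2 μ))) :
    (laplacian μ df a).graph = laplacianGraph μ df a :=
  Submodule.toLinearPMap_graph_eq _ fun x hx hx1 => by
    obtain ⟨u, w⟩ := x
    simp only at hx1
    subst hx1
    exact snd_eq_zero_of_mem_laplacianGraph hd hx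

theorem exists_laplacian_eq_iff (hd : Dense (sobolev ℂ μ df a : Set (Lp ℂ 2 μ)))
    {u w : Lp ℂ 2 μ} : (∃ h : u ∈ (laplacian μ df a).domain, laplacian μ df a ⟨u, h⟩ = w) ↔
      (u, w) ∈ laplacianGraph μ df a := by
  rw [← graph_laplacian hd, LinearPMap.mem_graph_iff]
  constructor
  · rintro ⟨h, hw⟩
    exact ⟨⟨u, h⟩, rfl, hw⟩
  · rintro ⟨y, rfl, hw⟩
    exact ⟨y.2, hw⟩

/-- The resolvent is self-adjoint and injective, hence has dense range, and its range lies in the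
domain. -/
theorem dense_laplacian_domain (hd : Dense (sobolev ℂ μ df a : Set (Lp ℂ 2 μ))) :
    Dense ((laplacian μ df a).domain : Set (Lp ℂ 2 μ)) := by
  have hr : Dense (Set.range (resolvent μ df a)) := by
    have h1 := (resolvent μ df a).orthogonal_range
    rw [isSelfAdjoint_resolvent.adjoint_eq,
      LinearMap.ker_eq_bot.2 (resolvent_injective hd)] at h1
    have h2 := (Submodule.topologicalClosure_eq_top_iff).2 h1
    exact Submodule.dense_iff_topologicalClosure_eq_top.2 h2
  refine hr.mono ?_
  rintro _ ⟨u, rfl⟩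
  exact ((exists_laplacian_eq_iff hd).2 (resolvent_mem_laplacianGraph u)).1

end FormDomain

/-! ### Hilbert–Schmidt integral operators -/

section Kernel

/-- Orthonormal vectors are at mutual distance `√2`, so balls of radius `1 / 2` around them are
disjoint open sets. -/
theorem countable_of_orthonormal {H : Type*} [NormedAddCommGroup H] [InnerProductSpace ℂ H]
    [TopologicalSpace.SeparableSpace H] {ι : Type*} {v : ι → H} (hv : Orthonormal ℂ v) :
    Countable ι := by
  refine Pairwise.countable_of_isOpen_disjoint (s := fun i => Metric.ball (v i) (1 / 2))
    (fun i j hij => Metric.ball_disjoint_ball ?_) (fun _ => Metric.isOpen_ball)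
    fun i => ⟨v i, Metric.mem_ball_self (by norm_num)⟩
  have h1 : ‖v i - v j‖ ^ 2 = 2 := by
    have := norm_sub_sq (𝕜 := ℂ) (v i) (v j)
    rw [hv.2 hij, hv.1 i, hv.1 j] at this
    norm_num at this
    exact this
  rw [dist_eq_norm]
  nlinarith [norm_nonneg (v i - v j)]

theorem enorm_sq_eq_lintegral {Ω : Type*} [MeasurableSpace Ω] {ν : Measure Ω} (f : Lp ℂ 2 ν) :
    ‖f‖ₑ ^ 2 = ∫⁻ ω, ‖f ω‖ₑ ^ 2 ∂ν := by
  rw [Lp.enorm_def, eLpNorm_eq_lintegral_rpow_enorm_toReal (by simp) (by simp),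
    ← ENNReal.rpow_natCast, ← ENNReal.rpow_mul]
  simp

theorem memLp_two_iff_lintegral {Ω : Type*} [MeasurableSpace Ω] {ν : Measure Ω} {f : Ω → ℂ}
    (hf : AEStronglyMeasurable f ν) : MemLp f 2 ν ↔ ∫⁻ ω, ‖f ω‖ₑ ^ 2 ∂ν < ∞ := by
  rw [MemLp, and_iff_right hf, eLpNorm_lt_top_iff_lintegral_rpow_enorm_lt_top (by simp) (by simp)]
  simp

variable {X : Type*} [MeasurableSpace X] {μ : Measure X} [IsFiniteMeasure μ] {k : X × X → ℂ}

/-- The values of the integral operator with kernel `k`. -/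
def kernelInt (μ : Measure X) (k : X × X → ℂ) (u : X → ℂ) (x : X) : ℂ :=
  ∫ y, k (x, y) * u y ∂μ

theorem ae_memLp_section (hk : MemLp k 2 (μ.prod μ)) :
    ∀ᵐ x ∂μ, MemLp (fun y => k (x, y)) 2 μ := by
  have h1 := (memLp_two_iff_lintegral hk.1).1 hk
  rw [lintegral_prod _ (hk.1.enorm.pow_const 2)] at h1
  filter_upwards [ae_lt_top' (hk.1.enorm.pow_const 2).lintegral_prod_right' h1.ne,
    hk.1.prodMk_left] with x hx hx'
  exact (memLp_two_iff_lintegral hx').2 hx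

/-- Writing the value at `x` as an inner product reduces linearity, the norm bound and the
Hilbert–Schmidt norm to facts about `L²`. -/
theorem kernelInt_eq_inner {x : X} (hx : MemLp (fun y => k (x, y)) 2 μ) (u : Lp ℂ 2 μ) :
    kernelInt μ k u x = ⟪(hx.star).toLp _, u⟫_ℂ := by
  rw [kernelInt, L2.inner_def]
  refine integral_congr_ae ?_
  filter_upwards [MemLp.coeFn_toLp hx.star] with y hy
  rw [hy, RCLike.inner_apply, mul_comm]
  simp

theorem enorm_toLp_star_sq {x : X} (hx : MemLp (fun y => k (x, y)) 2 μ) :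
    ‖(hx.star).toLp _‖ₑ ^ 2 = ∫⁻ y, ‖k (x, y)‖ₑ ^ 2 ∂μ := by
  rw [enorm_sq_eq_lintegral]
  refine lintegral_congr_ae ?_
  filter_upwards [MemLp.coeFn_toLp hx.star] with y hy
  rw [hy]
  simp [← ofReal_norm]

theorem lintegral_kernelInt_le (hk : MemLp k 2 (μ.prod μ)) (u : Lp ℂ 2 μ) :
    ∫⁻ x, ‖kernelInt μ k u x‖ₑ ^ 2 ∂μ ≤ (∫⁻ p, ‖k p‖ₑ ^ 2 ∂(μ.prod μ)) * ‖u‖ₑ ^ 2 := by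
  rw [lintegral_prod _ (hk.1.enorm.pow_const 2),
    ← lintegral_mul_const' _ _ (by finiteness)]
  refine lintegral_mono_ae ?_
  filter_upwards [ae_memLp_section hk] with x hx
  rw [kernelInt_eq_inner hx, ← enorm_toLp_star_sq hx, ← mul_pow]
  gcongr
  rw [← ofReal_norm, ← ofReal_norm, ← ofReal_norm, ← ENNReal.ofReal_mul (norm_nonneg _)]
  exact ENNReal.ofReal_le_ofReal (norm_inner_le_norm _ _)

theorem memLp_kernelInt (hk : MemLp k 2 (μ.prod μ)) (u : Lp ℂ 2 μ) :
    MemLp (kernelInt μ k u) 2 μ := by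
  refine (memLp_two_iff_lintegral ?_).2 ((lintegral_kernelInt_le hk u).trans_lt
    (ENNReal.mul_lt_top ((memLp_two_iff_lintegral hk.1).1 hk) (by finiteness)))
  exact (hk.1.mul (Lp.aestronglyMeasurable u).comp_snd).integral_prod_right'

/-- The Hilbert–Schmidt operator with kernel `k`. -/
def kernelOp (hk : MemLp k 2 (μ.prod μ)) : Lp ℂ 2 μ →L[ℂ] Lp ℂ 2 μ :=
  LinearMap.mkContinuous
    { toFun := fun u => (memLp_kernelInt hk u).toLp _
      map_add' := fun u v => by
        refine Lp.ext ?_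
        filter_upwards [MemLp.coeFn_toLp (memLp_kernelInt hk (u + v)),
          MemLp.coeFn_toLp (memLp_kernelInt hk u), MemLp.coeFn_toLp (memLp_kernelInt hk v),
          Lp.coeFn_add ((memLp_kernelInt hk u).toLp _) ((memLp_kernelInt hk v).toLp _),
          ae_memLp_section hk] with x h1 h2 h3 h4 h5
        rw [h1, h4, Pi.add_apply, h2, h3, kernelInt_eq_inner h5, kernelInt_eq_inner h5,
          kernelInt_eq_inner h5, inner_add_right]
      map_smul' := fun c u => by
        refine Lp.ext ?_
        filter_upwards [MemLp.coeFn_toLp (memLp_kernelInt hk (c • u)),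
          MemLp.coeFn_toLp (memLp_kernelInt hk u),
          Lp.coeFn_smul c ((memLp_kernelInt hk u).toLp _),
          ae_memLp_section hk] with x h1 h2 h4 h5
        rw [h1, RingHom.id_apply, h4, Pi.smul_apply, h2, kernelInt_eq_inner h5,
          kernelInt_eq_inner h5, inner_smul_right, smul_eq_mul] }
    √(∫⁻ p, ‖k p‖ₑ ^ 2 ∂(μ.prod μ)).toReal
    fun u => by
      have h := lintegral_kernelInt_le hk u
      have h1 : ‖(memLp_kernelInt hk u).toLp _‖ₑ ^ 2 = ∫⁻ x, ‖kernelInt μ k u x‖ₑ ^ 2 ∂μ := by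
        rw [enorm_sq_eq_lintegral]
        refine lintegral_congr_ae ?_
        filter_upwards [MemLp.coeFn_toLp (memLp_kernelInt hk u)] with x hx
        rw [hx]
      rw [← h1] at h
      have h2 := (memLp_two_iff_lintegral hk.1).1 hk
      have h3 := ENNReal.toReal_mono (ENNReal.mul_lt_top h2 (by finiteness)).ne h
      simp only [ENNReal.toReal_mul, ENNReal.toReal_pow, toReal_enorm] at h3
      refine abs_le_of_sq_le_sq' ?_ (by positivity) |>.2
      rwa [mul_pow, Real.sq_sqrt (by positivity)]

theorem kernelOp_ae (hk : MemLp k 2 (μ.prod μ)) (u : Lp ℂ 2 μ) :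
    kernelOp hk u =ᵐ[μ] kernelInt μ k u :=
  MemLp.coeFn_toLp (memLp_kernelInt hk u)

/-- For almost every `x`, Parseval for the section `k (x, ·)` gives its squared norm; then integrate
in `x`. Countability of the basis allows one exceptional null set for all `i` and the exchange of
sum and integral. -/
theorem tsum_enorm_kernelOp_sq {ι : Type*} [Countable ι] (hk : MemLp k 2 (μ.prod μ))
    (b : HilbertBasis ι ℂ (Lp ℂ 2 μ)) :
    ∑' i, ‖kernelOp hk (b i)‖ₑ ^ 2 = ∫⁻ p, ‖k p‖ₑ ^ 2 ∂(μ.prod μ) := by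
  simp_rw [enorm_sq_eq_lintegral]
  rw [← lintegral_tsum fun i => (Lp.aestronglyMeasurable _).enorm.pow_const 2,
    lintegral_prod _ (hk.1.enorm.pow_const 2)]
  refine lintegral_congr_ae ?_
  filter_upwards [ae_memLp_section hk, ae_all_iff.2 fun i => kernelOp_ae hk (b i)] with x hx hx'
  rw [← enorm_toLp_star_sq hx, ← tsum_enorm_inner_sq b]
  refine tsum_congr fun i => ?_
  rw [hx', kernelInt_eq_inner hx, ← inner_conj_symm, ← ofReal_norm, RCLike.norm_conj, ofReal_norm]

theorem hsNorm_kernelOp [MeasurableSpace.CountablyGenerated X] (hk : MemLp k 2 (μ.prod μ)) :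
    hsNorm (kernelOp hk) = (∫⁻ p, ‖k p‖ₑ ^ 2 ∂(μ.prod μ)) ^ (1 / 2 : ℝ) := by
  have : Fact ((2 : ℝ≥0∞) ≠ ∞) := ⟨by simp⟩
  have : Countable (basisIndex (Lp ℂ 2 μ)) :=
    countable_of_orthonormal (chosenBasis (Lp ℂ 2 μ)).orthonormal
  rw [hsNorm, tsum_enorm_kernelOp_sq]

theorem integrable_kernel_mul (hk : MemLp k 2 (μ.prod μ)) (v u : Lp ℂ 2 μ) :
    Integrable (fun p : X × X => (starRingEnd ℂ) (v p.1) * (k p * u p.2)) (μ.prod μ) := by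
  have h1 : MemLp (fun p : X × X => (starRingEnd ℂ) (v p.1) * u p.2) 2 (μ.prod μ) := by
    have hm := ((RCLike.continuous_conj (K := ℂ)).comp_aestronglyMeasurable
      (Lp.aestronglyMeasurable v)).comp_fst (ν := μ)
    refine (memLp_two_iff_lintegral (hm.mul (Lp.aestronglyMeasurable u).comp_snd)).2 ?_
    have h2 := lintegral_prod_mul (μ := μ) (ν := μ)
      ((Lp.aestronglyMeasurable v).enorm.pow_const 2)
      ((Lp.aestronglyMeasurable u).enorm.pow_const 2)
    rw [← enorm_sq_eq_lintegral, ← enorm_sq_eq_lintegral] at h2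
    have h3 : ∀ z : ℂ, ‖(starRingEnd ℂ) z‖ₑ = ‖z‖ₑ := fun z => by
      rw [← ofReal_norm, RCLike.norm_conj, ofReal_norm]
    calc ∫⁻ p : X × X, ‖(starRingEnd ℂ) (v p.1) * u p.2‖ₑ ^ 2 ∂(μ.prod μ)
        = ∫⁻ p : X × X, ‖v p.1‖ₑ ^ 2 * ‖u p.2‖ₑ ^ 2 ∂(μ.prod μ) := by
          simp only [enorm_mul, mul_pow, h3]
      _ < ∞ := by
          rw [h2]
          finiteness
  refine (h1.integrable_mul hk).congr (Eventually.of_forall fun p => ?_)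
  simp only [Pi.mul_apply]
  ring

theorem inner_kernelOp (hk : MemLp k 2 (μ.prod μ)) (v u : Lp ℂ 2 μ) :
    ⟪v, kernelOp hk u⟫_ℂ =
      ∫ p : X × X, (starRingEnd ℂ) (v p.1) * (k p * u p.2) ∂(μ.prod μ) := by
  rw [L2.inner_def, integral_prod _ (integrable_kernel_mul hk v u)]
  refine integral_congr_ae ?_
  filter_upwards [kernelOp_ae hk u] with x hx
  rw [hx, RCLike.inner_apply, mul_comm, kernelInt, integral_const_mul]

end Kernel

/-! ### The commutator as a Hilbert–Schmidt operator -/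

section Commutator

variable {X : Type*} [MetricSpace X] [MeasurableSpace X] [CompactSpace X] [BorelSpace X]
  {μ : Measure X} [IsFiniteMeasure μ] {df α β : ℝ}

/-- The energy density of a Hölder function of order `2 * α` is bounded. -/
theorem exists_lintegral_le_of_holder [Nontrivial X] (hdf : 0 < df) (hα : 0 < α)
    (hμ : IsAhlforsRegular μ df) {f : X → ℂ} {L : ℝ}
    (hf : ∀ x y, ‖f x - f y‖ ≤ L * dist x y ^ (2 * α)) :
    ∃ B : ℝ≥0∞, B < ∞ ∧ ∀ y, ∫⁻ x, ‖f x - f y‖ₑ ^ 2 /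
      ENNReal.ofReal (dist x y ^ (df + 2 * α)) ∂μ ≤ B := by
  obtain ⟨C, hC1, hC⟩ := hμ
  set D := Metric.diam (Set.univ : Set X) with hDdef
  have hD : 0 < D := Metric.diam_pos Set.nontrivial_univ isCompact_univ.isBounded
  have hdD : ∀ x y : X, dist x y ≤ D := fun x y =>
    Metric.dist_le_diam_of_mem isCompact_univ.isBounded (Set.mem_univ _) (Set.mem_univ _)
  -- The upper mass bound is also needed at radius `r 0 = D`, which regularity does not cover; the
  -- total mass supplies it.
  set C' := C + μ.real Set.univ / D ^ df with hC'
  have hC'0 : 0 < C' := by positivity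
  set r : ℕ → ℝ := fun n => D * (1 / 2) ^ n with hr
  have hr0 : ∀ n, 0 < r n := fun n => by positivity
  have hrs : ∀ n, r (n + 1) = r n / 2 := fun n => by simp only [hr, pow_succ]; ring
  have hball : ∀ y n, μ (Metric.closedBall y (r n)) ≤ ENNReal.ofReal (C' * r n ^ df) := by
    intro y n
    rcases n with _ | n
    · rw [← ofReal_measureReal]
      refine ENNReal.ofReal_le_ofReal ((measureReal_mono (Set.subset_univ _)).trans ?_)
      have : r 0 = D := by simp [hr]
      rw [this, hC', add_mul, div_mul_cancel₀ _ (by positivity)]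
      have : 0 ≤ C * D ^ df := by positivity
      linarith
    · have hlt : r (n + 1) < D := by
        have : (1 / 2 : ℝ) ^ (n + 1) < 1 := pow_lt_one₀ (by norm_num) (by norm_num) (by simp)
        simp only [hr]
        nlinarith
      refine (hC y _ (hr0 _).le hlt).2.trans (ENNReal.ofReal_le_ofReal ?_)
      have := hr0 (n + 1)
      gcongr
      rw [hC']
      have : 0 ≤ μ.real Set.univ / D ^ df := by positivity
      linarith
  set q : ℝ := (1 / 2) ^ (2 * α) with hq
  have hq0 : 0 < q := by positivity
  have hq1 : q < 1 := Real.rpow_lt_one (by norm_num) (by norm_num) (by linarith)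
  have hrq : ∀ n, r n ^ (2 * α) = D ^ (2 * α) * q ^ n := fun n => by
    simp only [hr]
    rw [Real.mul_rpow (by positivity) (by positivity), ← Real.rpow_natCast,
      ← Real.rpow_mul (x := (1 / 2 : ℝ)) (by norm_num), mul_comm (n : ℝ),
      Real.rpow_mul (x := (1 / 2 : ℝ)) (by norm_num), Real.rpow_natCast]
  -- `c n` bounds the integrand on the annulus `r n / 2 ≤ dist x y ≤ r n`. Multiplied by the ball's
  -- mass, of order `r n ^ df`, it is of order `r n ^ (2 * α)`, a geometric sequence.
  set c : ℕ → ℝ := fun n => L ^ 2 * (r n ^ (2 * α)) ^ 2 / (r n / 2) ^ (df + 2 * α) with hc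
  have hc0 : ∀ n, 0 ≤ c n := fun n => by have := hr0 n; positivity
  have hcC : ∀ n, c n * (C' * r n ^ df) =
      (L ^ 2 * 2 ^ (df + 2 * α) * C' * D ^ (2 * α)) * q ^ n := fun n => by
    have := hr0 n
    rw [mul_assoc _ _ (q ^ n), ← hrq]
    simp only [hc]
    rw [Real.div_rpow this.le (by norm_num), Real.rpow_add this]
    field_simp
  refine ⟨∑' n, ENNReal.ofReal (c n * (C' * r n ^ df)), ?_, fun y => ?_⟩
  · simp_rw [hcC]
    rw [← ENNReal.ofReal_tsum_of_nonneg (fun n => by positivity)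
      ((summable_geometric_of_lt_one hq0.le hq1).mul_left _)]
    simp
  calc ∫⁻ x, ‖f x - f y‖ₑ ^ 2 / ENNReal.ofReal (dist x y ^ (df + 2 * α)) ∂μ
      ≤ ∫⁻ x, ∑' n, (Metric.closedBall y (r n)).indicator
          (fun _ => ENNReal.ofReal (c n)) x ∂μ := by
        refine lintegral_mono fun x => ?_
        rcases eq_or_ne x y with rfl | hxy
        · simp
        have hd : 0 < dist x y := dist_pos.2 hxy
        obtain ⟨n, hn1, hn2⟩ : ∃ n, dist x y ≤ r n ∧ r n / 2 ≤ dist x y := by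
          have hrlim : Tendsto r atTop (𝓝 0) := by
            have := (tendsto_pow_atTop_nhds_zero_of_lt_one (r := (1 / 2 : ℝ)) (by norm_num)
              (by norm_num)).const_mul D
            simpa [hr, one_div] using this
          have hex : ∃ n, r (n + 1) < dist x y :=
            ((tendsto_order.1 (hrlim.comp (tendsto_add_atTop_nat 1))).2 _ hd).exists
          classical
          refine ⟨Nat.find hex, ?_, by rw [← hrs]; exact (Nat.find_spec hex).le⟩
          rcases h0 : Nat.find hex with _ | m
          · simpa [hr] using hdD x y
          · have := Nat.find_min hex (m := m) (by omega)
            linarith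
        refine le_trans ?_ (ENNReal.le_tsum n)
        rw [Set.indicator_of_mem (Metric.mem_closedBall.2 hn1),
          ← ofReal_norm, ← ENNReal.ofReal_pow (norm_nonneg _),
          ← ENNReal.ofReal_div_of_pos (by positivity)]
        refine ENNReal.ofReal_le_ofReal ?_
        have hrn := hr0 n
        have h1 : ‖f x - f y‖ ^ 2 ≤ L ^ 2 * (dist x y ^ (2 * α)) ^ 2 := by
          rw [← mul_pow]
          exact pow_le_pow_left₀ (norm_nonneg _) (hf x y) 2
        have h2 : 0 < df + 2 * α := by linarith
        have h3 : L ^ 2 * (dist x y ^ (2 * α)) ^ 2 ≤ L ^ 2 * (r n ^ (2 * α)) ^ 2 := by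
          gcongr
        simp only [hc]
        gcongr
        exact h1.trans h3
    _ = ∑' n, ENNReal.ofReal (c n) * μ (Metric.closedBall y (r n)) := by
        rw [lintegral_tsum fun n =>
          (measurable_const.indicator Metric.isClosed_closedBall.measurableSet).aemeasurable]
        refine tsum_congr fun n => ?_
        rw [lintegral_indicator_const Metric.isClosed_closedBall.measurableSet]
    _ ≤ _ := by
        refine ENNReal.tsum_le_tsum fun n => ?_
        rw [ENNReal.ofReal_mul (hc0 n)]
        gcongr
        exact hball y n

theorem mulOp_ae (f : C(X, ℂ)) (u : Lp ℂ 2 μ) : mulOp μ f u =ᵐ[μ] fun x => f x * u x :=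
  MemLp.coeFn_toLp (memLp_mul f u)

theorem inner_mulOp_star (f : C(X, ℂ)) (v w : Lp ℂ 2 μ) :
    ⟪mulOp μ (star f) v, w⟫_ℂ = ⟪v, mulOp μ f w⟫_ℂ := by
  rw [L2.inner_def, L2.inner_def]
  refine integral_congr_ae ?_
  filter_upwards [mulOp_ae (star f) v, mulOp_ae f w] with x h1 h2
  rw [h1, h2, RCLike.inner_apply, RCLike.inner_apply]
  simp
  ring

/-- Leibniz rule: `f x * v x - f y * v y = f x * (v x - v y) + v y * (f x - f y)`. The first term is
controlled by the supremum of `f` and the energy of `v`. For the second, integrating in `x` first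
leaves the bounded energy density of `f` against `‖v y‖ ^ 2`. -/
theorem mulOp_mem_sobolev [Nontrivial X] (hdf : 0 < df) (hα : 0 < α)
    (hμ : IsAhlforsRegular μ df) {f : C(X, ℂ)} {L : ℝ}
    (hf : ∀ x y, ‖f x - f y‖ ≤ L * dist x y ^ (2 * α)) {v : Lp ℂ 2 μ}
    (hv : v ∈ sobolev ℂ μ df α) : mulOp μ f v ∈ sobolev ℂ μ df α := by
  obtain ⟨B, hB, hfB⟩ := exists_lintegral_le_of_holder hdf hα hμ hf
  change energy μ df α (mulOp μ f v) < ∞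
  rw [energy_congr (mulOp_ae f v)]
  set w : X × X → ℝ≥0∞ := fun p => ENNReal.ofReal (dist p.1 p.2 ^ (df + 2 * α)) with hw
  have hwm : AEMeasurable w (μ.prod μ) := aemeasurable_weight μ _
  have hm2 : AEMeasurable (fun p : X × X => ‖v p.2‖ₑ ^ 2 * (‖f p.1 - f p.2‖ₑ ^ 2 / w p))
      (μ.prod μ) := by
    refine ((Lp.aestronglyMeasurable v).comp_snd.enorm.pow_const 2).mul
      (AEMeasurable.div (AEMeasurable.pow_const ?_ 2) hwm)
    exact ((f.continuous.comp continuous_fst).sub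
      (f.continuous.comp continuous_snd)).enorm.measurable.aemeasurable
  have h2 : ∫⁻ p : X × X, ‖v p.2‖ₑ ^ 2 * (‖f p.1 - f p.2‖ₑ ^ 2 / w p) ∂(μ.prod μ) < ∞ := by
    rw [lintegral_prod_symm _ hm2]
    calc _ ≤ ∫⁻ y, ‖v y‖ₑ ^ 2 * B ∂μ := by
          refine lintegral_mono fun y => ?_
          refine (lintegral_const_mul' (‖v y‖ₑ ^ 2) _ (by finiteness)).le.trans ?_
          gcongr
          exact hfB y
      _ < ∞ := by
          rw [lintegral_mul_const' _ _ hB.ne, ← enorm_sq_eq_lintegral]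
          exact ENNReal.mul_lt_top (by finiteness) hB
  have h1 : ∫⁻ p : X × X, 2 * (‖f‖ₑ ^ 2 * (‖v p.1 - v p.2‖ₑ ^ 2 / w p)) ∂(μ.prod μ) < ∞ := by
    rw [lintegral_const_mul' _ _ (by simp), lintegral_const_mul' _ _ (by finiteness)]
    exact ENNReal.mul_lt_top (by simp) (ENNReal.mul_lt_top (by finiteness) hv)
  refine lt_of_le_of_lt ?_ (ENNReal.add_lt_top.2 ⟨h1, ENNReal.mul_lt_top (a := 2) (by simp) h2⟩)
  rw [← lintegral_const_mul' _ _ (by simp), ← lintegral_add_right' _ (hm2.const_mul 2)]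
  refine lintegral_mono fun p => ?_
  change _ / w p ≤ _
  rw [← mul_div_assoc, ← mul_div_assoc, ← mul_div_assoc, ← mul_div_assoc, ← ENNReal.add_div]
  refine ENNReal.div_le_div_right ?_ _
  have h3 : ‖f p.1 * v p.1 - f p.2 * v p.2‖ₑ ≤
      ‖f‖ₑ * ‖v p.1 - v p.2‖ₑ + ‖v p.2‖ₑ * ‖f p.1 - f p.2‖ₑ := by
    rw [show f p.1 * v p.1 - f p.2 * v p.2 = f p.1 * (v p.1 - v p.2) + v p.2 * (f p.1 - f p.2) by
      ring]
    refine (enorm_add_le _ _).trans ?_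
    rw [enorm_mul, enorm_mul]
    gcongr
    rw [← ofReal_norm, ← ofReal_norm]
    exact ENNReal.ofReal_le_ofReal (f.norm_coe_le_norm _)
  refine (pow_le_pow_left' h3 2).trans ?_
  have h4 := ENNReal.rpow_add_le_mul_rpow_add_rpow (‖f‖ₑ * ‖v p.1 - v p.2‖ₑ)
    (‖v p.2‖ₑ * ‖f p.1 - f p.2‖ₑ) (p := 2) (by norm_num)
  norm_num [mul_pow, mul_add] at h4
  exact h4

/-- The kernel of the commutator `[Δ_a, m_f]`. -/
def commKernel (df a : ℝ) (f : X → ℂ) (p : X × X) : ℂ :=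
  (f p.1 - f p.2) / ((dist p.1 p.2 ^ (df + 2 * a) : ℝ) : ℂ)

theorem aestronglyMeasurable_commKernel (f : C(X, ℂ)) :
    AEStronglyMeasurable (commKernel df α f) (μ.prod μ) := by
  have hw : Measurable (fun p : X × X => ((dist p.1 p.2 ^ (df + 2 * α) : ℝ) : ℂ)) := by
    have : Measurable (fun p : X × X => dist p.1 p.2) := continuous_dist.measurable
    exact Complex.measurable_ofReal.comp (this.pow_const _)
  have hf : Measurable (fun p : X × X => f p.1 - f p.2) :=
    ((f.continuous.comp continuous_fst).sub (f.continuous.comp continuous_snd)).measurable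
  exact (hf.div hw).aestronglyMeasurable

theorem energy_coe_toL2 (a : ℝ) (f : C(X, ℂ)) : energy μ df a (toL2 μ f) = energy μ df a f :=
  energy_congr (ContinuousMap.coeFn_toLp (𝕜 := ℂ) μ f)

/-- This identity fixes `β`: the squared kernel has weight exponent `2 * (df + 2 * α) = df + 2 * β`.
-/
theorem lintegral_commKernel (hβ : β = df / 2 + 2 * α) (f : X → ℂ) :
    ∫⁻ p, ‖commKernel df α f p‖ₑ ^ 2 ∂(μ.prod μ) = energy μ df β f := by
  refine lintegral_congr fun p => ?_
  rcases eq_or_ne p.1 p.2 with h | h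
  · simp [commKernel, h]
  have hd := dist_pos.2 h
  rw [← ofReal_norm, ← ofReal_norm, ← ENNReal.ofReal_pow (norm_nonneg _),
    ← ENNReal.ofReal_pow (norm_nonneg _), ← ENNReal.ofReal_div_of_pos (by positivity),
    commKernel, norm_div, Complex.norm_real, Real.norm_of_nonneg (by positivity), div_pow,
    ← Real.rpow_natCast (dist p.1 p.2 ^ _), ← Real.rpow_mul hd.le]
  congr 3
  rw [hβ]
  push_cast
  ring

theorem memLp_commKernel (hβ : β = df / 2 + 2 * α) {f : C(X, ℂ)} (hf : f ∈ contSobolev μ df β) :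
    MemLp (commKernel df α f) 2 (μ.prod μ) := by
  rw [memLp_two_iff_lintegral (aestronglyMeasurable_commKernel f), lintegral_commKernel hβ,
    ← energy_coe_toL2]
  exact hf

/-- The weak form of the commutator identity. The integrands of the two forms differ by `conj (v x)
* k (x, y) * u y` plus the same term with `x` and `y` exchanged, where `k` is the commutator kernel.
Both have the same integral, which cancels the `1 / 2` in the form. -/
theorem form_mulOp_sub {f : C(X, ℂ)} (hk : MemLp (commKernel df α f) 2 (μ.prod μ))
    {v u : Lp ℂ 2 μ} (hv : v ∈ sobolev ℂ μ df α) (hu : u ∈ sobolev ℂ μ df α)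
    (hfv : mulOp μ (star f) v ∈ sobolev ℂ μ df α) (hfu : mulOp μ f u ∈ sobolev ℂ μ df α) :
    form μ df α v (mulOp μ f u) =
      form μ df α (mulOp μ (star f) v) u + ⟪v, kernelOp hk u⟫_ℂ := by
  have hG := integrable_kernel_mul hk v u
  have hA := integrable_form hv hfu
  have hB := integrable_form hfv hu
  rw [inner_kernelOp, ← sub_eq_iff_eq_add']
  unfold form
  rw [← mul_sub, ← integral_sub hA hB]
  have h1 : ∫ p : X × X, (starRingEnd ℂ) (v p.2) * (commKernel df α f p.swap * u p.1)
      ∂(μ.prod μ) = ∫ p : X × X, (starRingEnd ℂ) (v p.1) * (commKernel df α f p * u p.2)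
      ∂(μ.prod μ) :=
    integral_prod_swap
      (fun p : X × X => (starRingEnd ℂ) (v p.1) * (commKernel df α f p * u p.2))
  have h2 : ∫ p : X × X, ((starRingEnd ℂ) (v p.1) * (commKernel df α f p * u p.2) +
      (starRingEnd ℂ) (v p.2) * (commKernel df α f p.swap * u p.1)) ∂(μ.prod μ) =
      2 * ∫ p : X × X, (starRingEnd ℂ) (v p.1) * (commKernel df α f p * u p.2) ∂(μ.prod μ) := by
    exact (integral_add hG hG.swap).trans ((congrArg _ h1).trans (two_mul _).symm)
  rw [← mul_right_inj' (two_ne_zero (α := ℂ)), ← h2, ← mul_assoc]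
  norm_num
  refine integral_congr_ae ?_
  filter_upwards [Measure.quasiMeasurePreserving_fst.ae (mulOp_ae f u),
    Measure.quasiMeasurePreserving_snd.ae (mulOp_ae f u),
    Measure.quasiMeasurePreserving_fst.ae (mulOp_ae (star f) v),
    Measure.quasiMeasurePreserving_snd.ae (mulOp_ae (star f) v)] with p h3 h4 h5 h6
  rw [h3, h4, h5, h6]
  simp only [commKernel, Prod.fst_swap, Prod.snd_swap, dist_comm p.2 p.1, ContinuousMap.star_apply,
    RCLike.star_def, map_mul, RingHomCompTriple.comp_apply, RingHom.id_apply]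
  ring

/-- The weak identity places `(f u, f Δ_α u + T u)`, with `T` the kernel operator, in the graph of
`Δ_α`. Testing against `v` moves `f` onto `v` as `star f`, which satisfies the same Hölder bound. -/
theorem extendsCommutator_kernelOp [Nontrivial X] (hdf : 0 < df) (hα : 0 < α)
    (hμ : IsAhlforsRegular μ df) (hd : Dense (sobolev ℂ μ df α : Set (Lp ℂ 2 μ)))
    {f : C(X, ℂ)} (hk : MemLp (commKernel df α f) 2 (μ.prod μ)) {L : ℝ}
    (hf : ∀ x y, ‖f x - f y‖ ≤ L * dist x y ^ (2 * α)) :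
    ExtendsCommutator μ df α f (kernelOp hk) := by
  intro u
  have hu := (exists_laplacian_eq_iff hd).1 ⟨u.2, rfl⟩
  rw [mem_laplacianGraph_iff] at hu
  have hfs : ∀ x y, ‖star f x - star f y‖ ≤ L * dist x y ^ (2 * α) := fun x y => by
    refine le_trans (le_of_eq ?_) (hf x y)
    rw [ContinuousMap.star_apply, ContinuousMap.star_apply, ← star_sub, norm_star]
  have hfu := mulOp_mem_sobolev hdf hα hμ hf hu.1
  have hg : (mulOp μ f u, mulOp μ f (laplacian μ df α u) + kernelOp hk u) ∈
      laplacianGraph μ df α := by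
    refine mem_laplacianGraph_iff.2 ⟨hfu, fun v hv => ?_⟩
    have hfv := mulOp_mem_sobolev hdf hα hμ hfs hv
    rw [form_mulOp_sub hk hv hu.1 hfv hfu, hu.2 _ hfv, inner_mulOp_star, inner_add_right]
  obtain ⟨h, h'⟩ := (exists_laplacian_eq_iff hd).2 hg
  exact ⟨h, by rw [h', add_sub_cancel_left]⟩

theorem ExtendsCommutator.unique {a : ℝ} (hd : Dense (sobolev ℂ μ df a : Set (Lp ℂ 2 μ)))
    {f : C(X, ℂ)} {S T : Lp ℂ 2 μ →L[ℂ] Lp ℂ 2 μ} (hS : ExtendsCommutator μ df a f S)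
    (hT : ExtendsCommutator μ df a f T) : S = T := by
  refine ContinuousLinearMap.coeFn_injective
    (S.continuous.ext_on (dense_laplacian_domain hd) T.continuous fun u hu => ?_)
  obtain ⟨h1, h1'⟩ := hS ⟨u, hu⟩
  obtain ⟨h2, h2'⟩ := hT ⟨u, hu⟩
  exact h1'.trans h2'.symm

/-- The domain of `Δ_α` is dense, so the kernel operator is the only bounded extension and the
infimum runs over a single operator. -/
theorem commutatorNorm_eq [Nontrivial X] (hdf : 0 < df) (hα : 0 < α) (hβ : β = df / 2 + 2 * α)
    (hμ : IsAhlforsRegular μ df) (hd : Dense (sobolev ℂ μ df α : Set (Lp ℂ 2 μ)))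
    {f : C(X, ℂ)} (hf : f ∈ contSobolev μ df β) :
    commutatorNorm μ df α f = energy μ df β f ^ (1 / 2 : ℝ) := by
  have := hμ.isOpenPosMeasure
  have hk := memLp_commKernel hβ hf
  obtain ⟨K, -, hK⟩ := exists_holder_representative hdf (s := 2 * α) (by linarith) hμ
  have hf' : energy μ df (df / 2 + 2 * α) (toL2 μ f) < ∞ := by rw [← hβ]; exact hf
  obtain ⟨g, hg, hg'⟩ := hK _ hf'
  obtain rfl : g = f := ContinuousMap.toLp_injective (𝕜 := ℂ) μ hg
  have hT := extendsCommutator_kernelOp hdf hα hμ hd hk hg'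
  rw [← lintegral_commKernel (μ := μ) hβ, ← hsNorm_kernelOp hk, commutatorNorm]
  refine le_antisymm (iInf₂_le _ hT) (le_iInf₂ fun S hS => ?_)
  rw [hS.unique hd hT]

end Commutator

/-! ### Density below the walk dimension and compact embedding -/

section Embedding

variable {X : Type*} [MetricSpace X] [MeasurableSpace X] [CompactSpace X] [BorelSpace X]
  {μ : Measure X} [IsFiniteMeasure μ] {df a b : ℝ}

theorem energy_le_mul_energy (hab : a ≤ b) (f : X → ℂ) :
    energy μ df a f ≤ ENNReal.ofReal (Metric.diam (Set.univ : Set X) ^ (2 * (b - a))) *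
      energy μ df b f := by
  unfold energy
  rw [← lintegral_const_mul' _ _ (by simp)]
  refine lintegral_mono fun p => ?_
  rcases eq_or_ne p.1 p.2 with h | h
  · simp [h]
  have hd := dist_pos.2 h
  have hdD : dist p.1 p.2 ≤ Metric.diam (Set.univ : Set X) :=
    Metric.dist_le_diam_of_mem isCompact_univ.isBounded (Set.mem_univ _) (Set.mem_univ _)
  rw [← ofReal_norm, ← ENNReal.ofReal_pow (norm_nonneg _),
    ← ENNReal.ofReal_div_of_pos (by positivity), ← ENNReal.ofReal_div_of_pos (by positivity),
    ← ENNReal.ofReal_mul (Real.rpow_nonneg Metric.diam_nonneg _)]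
  refine ENNReal.ofReal_le_ofReal ?_
  calc ‖f p.1 - f p.2‖ ^ 2 / dist p.1 p.2 ^ (df + 2 * a)
      = dist p.1 p.2 ^ (2 * (b - a)) *
          (‖f p.1 - f p.2‖ ^ 2 / dist p.1 p.2 ^ (df + 2 * b)) := by
        rw [show df + 2 * b = 2 * (b - a) + (df + 2 * a) by ring,
          Real.rpow_add hd (2 * (b - a)), mul_div_assoc',
          mul_div_mul_left _ _ (Real.rpow_pos_of_pos hd _).ne']
    _ ≤ _ := by
        gcongr

theorem sobolev_anti (hab : a ≤ b) : sobolev ℂ μ df b ≤ sobolev ℂ μ df a := fun f hf =>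
  (energy_le_mul_energy hab f).trans_lt (ENNReal.mul_lt_top (by simp) hf)

theorem energy_ofReal (f : X → ℝ) : energy μ df a (fun x => (f x : ℂ)) = energy μ df a f := by
  unfold energy
  refine lintegral_congr fun p => ?_
  rw [← Complex.ofReal_sub, ← ofReal_norm, Complex.norm_real, ofReal_norm]

/-- Below the walk dimension, the Sobolev space is dense in `L²`. -/
theorem dense_sobolev_of_lt_walkDim (h : ENNReal.ofReal (2 * b) < walkDim μ df) :
    Dense (sobolev ℂ μ df b : Set (Lp ℂ 2 μ)) := by
  obtain ⟨_, ⟨a, ha, rfl, F, hF, -, hreg⟩, hab⟩ := lt_sSup_iff.1 h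
  have hab' : b ≤ a := by
    have := (ENNReal.ofReal_lt_ofReal_iff (by linarith)).1 hab
    linarith
  have hmem : ∀ φ : C(X, ℝ), ContinuousMap.toLp (E := ℝ) 2 μ ℝ φ ∈ F →
      toL2 μ (ContinuousLinearMap.compLeftContinuous ℝ X Complex.ofRealCLM φ) ∈
        sobolev ℂ μ df b := by
    intro φ hφ
    refine sobolev_anti hab' ?_
    have h1 : energy μ df a (ContinuousMap.toLp (E := ℝ) 2 μ ℝ φ) < ∞ := hF hφ
    rw [energy_congr (ContinuousMap.coeFn_toLp (𝕜 := ℝ) μ φ), ← energy_ofReal] at h1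
    change energy μ df a _ < ∞
    rw [energy_coe_toL2]
    exact h1
  -- The regular form is real, so density is transferred to complex functions through real and
  -- imaginary parts.
  set Φ : C(X, ℝ) × C(X, ℝ) → C(X, ℂ) := fun q =>
    ContinuousLinearMap.compLeftContinuous ℝ X Complex.ofRealCLM q.1 +
      Complex.I • ContinuousLinearMap.compLeftContinuous ℝ X Complex.ofRealCLM q.2 with hΦ
  have hΦc : Continuous Φ := by
    have h1 := (ContinuousLinearMap.compLeftContinuous ℝ X Complex.ofRealCLM).continuous
    exact (h1.comp continuous_fst).add ((h1.comp continuous_snd).const_smul Complex.I)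
  have hΦs : Function.Surjective Φ := fun f => by
    refine ⟨(ContinuousLinearMap.compLeftContinuous ℝ X Complex.reCLM f,
      ContinuousLinearMap.compLeftContinuous ℝ X Complex.imCLM f), ?_⟩
    ext x
    simp [hΦ, mul_comm Complex.I, Complex.re_add_im]
  have h2 := ((ContinuousMap.toLp_denseRange ℂ μ ℂ (p := 2) (by simp)).comp hΦs.denseRange
    (ContinuousMap.toLp (E := ℂ) 2 μ ℂ).continuous).dense_image
    ((ContinuousMap.toLp (E := ℂ) 2 μ ℂ).continuous.comp hΦc) (hreg.dense_sup.prod hreg.dense_sup)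
  refine h2.mono ?_
  rintro _ ⟨q, hq, rfl⟩
  change toL2 μ (Φ q) ∈ sobolev ℂ μ df b
  rw [hΦ]
  simp only [toL2, map_add, map_smul]
  exact Submodule.add_mem _ (hmem _ hq.1) (Submodule.smul_mem _ _ (hmem _ hq.2))

theorem energy_fst_eq {z : WithLp 2 (Lp ℂ 2 μ × Lp ℂ 2 (μ.prod μ))}
    (hz : z ∈ formGraph μ df a) : energy μ df a z.fst = 2 * ‖z.snd‖ₑ ^ 2 := by
  rw [energy_eq_lintegral_diffQuot, enorm_sq_eq_lintegral]
  congr 1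
  refine lintegral_congr_ae ?_
  filter_upwards [hz] with p hp
  rw [hp]

/-- Comparing `g` with the constant `g x` bounds the supremum by the `L²` norm and the oscillation,
as Arzelà–Ascoli requires. -/
theorem norm_mul_norm_toL2_one_le {g : C(X, ℂ)} {B : ℝ} (hB : ∀ x y, ‖g x - g y‖ ≤ B) (x : X) :
    ‖g x‖ * ‖toL2 μ 1‖ ≤ ‖toL2 μ g‖ + ‖ContinuousMap.toLp (E := ℂ) 2 μ ℂ‖ * B := by
  have hB0 : 0 ≤ B := (norm_nonneg _).trans (hB x x)
  have h1 : g x • (1 : C(X, ℂ)) = g + (g x • 1 - g) := by abel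
  have h2 : ‖g x • (1 : C(X, ℂ)) - g‖ ≤ B := by
    rw [ContinuousMap.norm_le _ hB0]
    intro y
    simpa using hB x y
  rw [← norm_smul, ← map_smul, h1, map_add]
  exact (norm_add_le _ _).trans (add_le_add le_rfl
    (((ContinuousMap.toLp (E := ℂ) 2 μ ℂ).le_opNorm _).trans (by gcongr)))

theorem toL2_one_ne_zero [Nonempty X] [μ.IsOpenPosMeasure] : toL2 μ 1 ≠ 0 := by
  rw [← map_zero (ContinuousMap.toLp (E := ℂ) 2 μ ℂ)]
  exact fun h => one_ne_zero (ContinuousMap.toLp_injective (𝕜 := ℂ) μ h)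

/-- Elements of the form unit ball have representatives with a common Hölder constant and a common
supremum bound. Arzelà–Ascoli makes this family relatively compact in the supremum norm, hence in
`L²`. The `√2` arises because the energy is `2 * ‖z.snd‖ ^ 2`. -/
theorem isCompactOperator_formIncl [Nontrivial X] {s : ℝ} (hdf : 0 < df) (hs : 0 < s)
    (hμ : IsAhlforsRegular μ df) : IsCompactOperator (formIncl μ df (df / 2 + s)) := by
  have := hμ.isOpenPosMeasure
  obtain ⟨K, hK0, hK⟩ := exists_holder_representative hdf hs hμ
  set D := Metric.diam (Set.univ : Set X) with hDdef
  set L := K * √2 with hL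
  have hL0 : 0 ≤ L := by positivity
  set N := ‖ContinuousMap.toLp (E := ℂ) 2 μ ℂ‖ with hN
  set m := ‖toL2 μ 1‖ with hm
  have hm0 : 0 < m := norm_pos_iff.2 toL2_one_ne_zero
  set A : Set (BoundedContinuousFunction X ℂ) :=
    {g | (∀ x, g x ∈ Metric.closedBall (0 : ℂ) ((1 + N * (L * D ^ s)) / m)) ∧
      ∀ x y, ‖g x - g y‖ ≤ L * dist x y ^ s} with hA
  have hAc : IsCompact (closure A) := by
    refine BoundedContinuousFunction.arzela_ascoli _ (isCompact_closedBall _ _) A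
      (fun g x hg => hg.1 x) ?_
    have hlim : Tendsto (fun t : ℝ => L * t ^ s) (𝓝 0) (𝓝 0) := by
      have := (tendsto_id (x := 𝓝 (0 : ℝ))).rpow_const (p := s) (Or.inr hs.le)
      simpa [Real.zero_rpow hs.ne'] using this.const_mul L
    refine (Metric.uniformEquicontinuous_of_continuity_modulus _ hlim _ ?_).equicontinuous
    intro x y g
    rw [dist_eq_norm]
    exact g.2.2 x y
  rw [isCompactOperator_iff_exists_mem_nhds_image_subset_compact]
  refine ⟨Metric.ball 0 1, Metric.ball_mem_nhds _ one_pos, _,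
    hAc.image (BoundedContinuousFunction.toLp (E := ℂ) 2 μ ℂ).continuous, ?_⟩
  rintro _ ⟨z, hz, rfl⟩
  rw [mem_ball_zero_iff] at hz
  have hz1 : ‖z.1.fst‖ ≤ 1 := (WithLp.norm_fst_le _ z.1).trans hz.le
  have hz2 : ‖z.1.snd‖ ≤ 1 := (WithLp.norm_snd_le _ z.1).trans hz.le
  have hE := energy_fst_eq z.2
  obtain ⟨g, hg, hg'⟩ := hK z.1.fst (fst_mem_sobolev z.2)
  have hE2 : √(energy μ df (df / 2 + s) z.1.fst).toReal ≤ √2 := by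
    refine Real.sqrt_le_sqrt ?_
    rw [hE]
    simp only [ENNReal.toReal_mul, ENNReal.toReal_pow, toReal_enorm, ENNReal.toReal_ofNat]
    nlinarith [norm_nonneg z.1.snd]
  have hgL : ∀ x y, ‖g x - g y‖ ≤ L * dist x y ^ s := fun x y =>
    (hg' x y).trans (by rw [hL]; gcongr)
  have hgB : ∀ x y, ‖g x - g y‖ ≤ L * D ^ s := fun x y => (hgL x y).trans (by
    gcongr
    exact Metric.dist_le_diam_of_mem isCompact_univ.isBounded (Set.mem_univ _) (Set.mem_univ _))
  refine ⟨BoundedContinuousFunction.mkOfCompact g, subset_closure ⟨fun x => ?_, hgL⟩, ?_⟩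
  · rw [mem_closedBall_zero_iff, le_div_iff₀ hm0]
    refine (norm_mul_norm_toL2_one_le hgB x).trans ?_
    rw [hg]
    gcongr
  · rw [formIncl_apply, ← hg]
    exact Lp.ext ((BoundedContinuousFunction.coeFn_toLp (𝕜 := ℂ) (μ := μ) (p := 2) _).trans
      (ContinuousMap.coeFn_toLp (𝕜 := ℂ) μ g).symm)

end Embedding

/-! ### Compact symmetric operators and the enumeration of eigenvalues -/

theorem exists_equiv_nat_monotone {ι : Type*} [Countable ι] [Infinite ι] (l : ι → ℝ)
    (hl : ∀ c, {i | l i ≤ c}.Finite) : ∃ e : ℕ ≃ ι, Monotone (l ∘ e) := by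
  obtain ⟨c, hc⟩ := exists_injective_nat ι
  -- Order the indices by value, breaking ties by an arbitrary numbering. Initial segments are
  -- finite and there is no largest element, so the order is that of `ℕ`.
  have hk : Function.Injective (fun i => toLex (l i, c i)) := fun i j hij =>
    hc (congrArg (fun p => (ofLex p).2) hij)
  let _ : LinearOrder ι := LinearOrder.lift' _ hk
  have hle : ∀ {i j : ι}, i ≤ j → l i ≤ l j := fun {i j} h => by
    have h' : toLex (l i, c i) ≤ toLex (l j, c j) := h
    exact (Prod.Lex.le_iff.1 h').elim le_of_lt fun h => h.1.le
  have hfin : ∀ j : ι, (Set.Iic j).Finite := fun j => (hl (l j)).subset fun i hi => hle hi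
  let _ : LocallyFiniteOrder ι :=
    LocallyFiniteOrder.ofFiniteIcc fun a b => (hfin b).subset Set.Icc_subset_Iic_self
  let _ : SuccOrder ι := LinearLocallyFiniteOrder.succOrder ι
  let _ : PredOrder ι := LinearLocallyFiniteOrder.predOrder ι
  have : NoMaxOrder ι := ⟨fun j => by
    by_contra! h
    exact Set.infinite_univ ((hfin j).subset fun i _ => h i)⟩
  obtain ⟨m, hm⟩ : ∃ m : ι, ∀ i, m ≤ i := by
    obtain ⟨j⟩ := (inferInstance : Nonempty ι)
    obtain ⟨m, hm, hm'⟩ := Set.exists_min_image (Set.Iic j) id (hfin j) ⟨j, Set.mem_Iic.2 le_rfl⟩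
    exact ⟨m, fun i => (le_total i j).elim (hm' i) (le_trans hm)⟩
  let _ : OrderBot ι := { bot := m, bot_le := hm }
  exact ⟨orderIsoNatOfLinearSuccPredArch.symm.toEquiv, fun i j hij =>
    hle (orderIsoNatOfLinearSuccPredArch.symm.monotone hij)⟩

section CompactOperator

universe u

variable {H : Type u} [NormedAddCommGroup H] [InnerProductSpace ℂ H]

theorem exists_orthonormal_eigenvectors [CompleteSpace H] {G : H →L[ℂ] H}
    (hc : IsCompactOperator G) (hs : (G : H →ₗ[ℂ] H).IsSymmetric) :
    ∃ (ι : Type u) (v : ι → H) (κ : ι → ℝ), Orthonormal ℂ v ∧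
      (∀ i, G (v i) = (κ i : ℂ) • v i) ∧ (Submodule.span ℂ (Set.range v))ᗮ = ⊥ := by
  have hcl : ∀ c : ℂ, IsClosed (Module.End.eigenspace (G : H →ₗ[ℂ] H) c : Set H) := fun c => by
    have h1 : (Module.End.eigenspace (G : H →ₗ[ℂ] H) c : Set H) = {x | G x = c • x} := by
      ext x
      exact Module.End.mem_eigenspace_iff
    rw [h1]
    exact isClosed_eq G.continuous (continuous_const_smul c)
  have : ∀ c : ℂ, CompleteSpace (Module.End.eigenspace (G : H →ₗ[ℂ] H) c) := fun c =>
    (hcl c).completeSpace_coe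
  -- An orthonormal basis is chosen in each eigenspace, the kernel included. Symmetry makes these
  -- spaces orthogonal and the eigenvalues real; the spectral theorem makes the union total.
  choose w b hb using fun c : ℂ =>
    exists_hilbertBasis ℂ (Module.End.eigenspace (G : H →ₗ[ℂ] H) c)
  set v : (Σ c : ℂ, w c) → H := fun i => (b i.1 i.2 : H) with hv
  have hvo : Orthonormal ℂ v :=
    hs.orthogonalFamily_eigenspaces.orthonormal_sigma_orthonormal fun c => (b c).orthonormal
  have hGv : ∀ i, G (v i) = i.1 • v i := fun i => Module.End.mem_eigenspace_iff.1 (b i.1 i.2).2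
  refine ⟨_, v, fun i => i.1.re, hvo, fun i => ?_, ?_⟩
  · have h1 := hs.conj_eigenvalue_eq_self (μ := i.1)
      (Module.End.hasEigenvalue_of_hasEigenvector ⟨(b i.1 i.2).2, hvo.ne_zero i⟩)
    rw [Complex.conj_eq_iff_re.1 h1, hGv]
  · rw [eq_bot_iff, ← ContinuousLinearMap.orthogonalComplement_iSup_eigenspaces_eq_bot hc hs]
    intro x hx
    rw [← Submodule.iInf_orthogonal, Submodule.mem_iInf]
    refine fun c => (Submodule.mem_orthogonal' _ _).2 fun y hy => ?_
    have h1 := ((b c).hasSum_repr ⟨y, hy⟩).mapL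
      ((innerSL ℂ x).comp (Module.End.eigenspace (G : H →ₗ[ℂ] H) c).subtypeL)
    have h2 : ∀ i, ((innerSL ℂ x).comp (Module.End.eigenspace (G : H →ₗ[ℂ] H) c).subtypeL)
        ((b c).repr ⟨y, hy⟩ i • b c i) = 0 := fun i => by
      have h3 : ⟪x, v ⟨c, i⟩⟫_ℂ = 0 :=
        (Submodule.mem_orthogonal' _ _).1 hx _ (Submodule.subset_span ⟨_, rfl⟩)
      rw [map_smul]
      exact (congrArg _ h3).trans (smul_zero _)
    rw [funext h2] at h1
    exact h1.unique hasSum_zero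

/-- Infinitely many such eigenvectors would have mutually orthogonal images of norm at least `ε`, a
sequence without a Cauchy subsequence in a relatively compact set. -/
theorem finite_setOf_le_eigenvalue {G : H →L[ℂ] H} (hc : IsCompactOperator G) {ι : Type*}
    {v : ι → H} {κ : ι → ℝ} (hv : Orthonormal ℂ v) (hG : ∀ i, G (v i) = (κ i : ℂ) • v i)
    {ε : ℝ} (hε : 0 < ε) : {i | ε ≤ κ i}.Finite := by
  by_contra hinf
  set e := Set.Infinite.natEmbedding _ hinf with he
  have hK := hc.isCompact_closure_image_closedBall (1 : ℝ)
  obtain ⟨y, -, φ, hφ, hy⟩ := hK.tendsto_subseq (x := fun n => G (v (e n))) fun n =>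
    subset_closure ⟨v (e n), by simp [hv.1], rfl⟩
  obtain ⟨N, hN⟩ := Metric.cauchySeq_iff.1 hy.cauchySeq ε hε
  have h1 := hN N le_rfl (N + 1) (by omega)
  have hne : (e (φ N) : ι) ≠ e (φ (N + 1)) := fun h => by
    have := hφ.injective (e.injective (Subtype.ext h))
    omega
  simp only [Function.comp_apply, hG] at h1
  have h2 := norm_sub_sq (𝕜 := ℂ) ((κ (e (φ N)) : ℂ) • v (e (φ N)))
    ((κ (e (φ (N + 1))) : ℂ) • v (e (φ (N + 1))))
  rw [inner_smul_left, inner_smul_right, hv.2 hne, norm_smul, norm_smul, hv.1, hv.1] at h2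
  simp only [mul_zero, map_zero, sub_zero, mul_one, Complex.norm_real, Real.norm_eq_abs,
    sq_abs] at h2
  have h3 : ε ≤ κ (e (φ N)) := (e (φ N)).2
  rw [dist_eq_norm] at h1
  nlinarith [sq_nonneg (κ (e (φ (N + 1)))), norm_nonneg ((κ (e (φ N)) : ℂ) • v (e (φ N)) -
    (κ (e (φ (N + 1))) : ℂ) • v (e (φ (N + 1))))]

end CompactOperator

/-! ### Eigenbasis of the Laplacian -/

section Eigenbasis

variable {X : Type*} [MetricSpace X] [MeasurableSpace X] [CompactSpace X] [BorelSpace X]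
  {μ : Measure X} [IsFiniteMeasure μ] {df a b : ℝ}

theorem exists_inner_resolvent_self (u : Lp ℂ 2 μ) :
    ∃ r : ℝ, 0 ≤ r ∧ ⟪u, resolvent μ df a u⟫_ℂ = r := by
  refine ⟨‖ContinuousLinearMap.adjoint (formIncl μ df a) u‖ ^ 2, by positivity, ?_⟩
  refine (ContinuousLinearMap.adjoint_inner_left (formIncl μ df a)
    (ContinuousLinearMap.adjoint (formIncl μ df a) u) u).symm.trans ?_
  rw [inner_self_eq_norm_sq_to_K]
  push_cast
  rfl

/-- The resolvent is injective and of the form `J J*`, so `κ > 0`; dividing the resolvent equation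
by `κ` yields the eigenvalue `κ⁻¹ - 1`. -/
theorem eigenvalue_of_resolvent (hd : Dense (sobolev ℂ μ df a : Set (Lp ℂ 2 μ))) {u : Lp ℂ 2 μ}
    {κ : ℝ} (hu : ‖u‖ = 1) (h : resolvent μ df a u = (κ : ℂ) • u) :
    0 < κ ∧ (u, ((κ⁻¹ - 1 : ℝ) : ℂ) • u) ∈ laplacianGraph μ df a := by
  have h1 : κ ≠ 0 := fun h0 => by
    rw [h0, Complex.ofReal_zero, zero_smul, ← map_zero (resolvent μ df a)] at h
    have := resolvent_injective hd h
    simp [this] at hu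
  have hκ : 0 < κ := by
    refine lt_of_le_of_ne ?_ h1.symm
    obtain ⟨r, hr, h2⟩ := exists_inner_resolvent_self (df := df) (a := a) u
    rw [h, inner_smul_right, inner_self_eq_norm_sq_to_K, hu, RCLike.ofReal_one, one_pow,
      mul_one] at h2
    rwa [Complex.ofReal_injective h2]
  refine ⟨hκ, ?_⟩
  have h2 := (laplacianGraph μ df a).smul_mem ((κ : ℂ)⁻¹) (resolvent_mem_laplacianGraph u)
  have hne : (κ : ℂ) ≠ 0 := by exact_mod_cast hκ.ne'
  rw [h, Prod.smul_mk, smul_sub, smul_smul, inv_mul_cancel₀ hne, one_smul] at h2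
  rwa [Complex.ofReal_sub, sub_smul, Complex.ofReal_inv, Complex.ofReal_one, one_smul]

/-- `L²` is infinite-dimensional: it has no finite orthonormal basis of continuous functions. -/
theorem infinite_of_hilbertBasis [Nontrivial X] (hdf : 0 < df) (hμ : IsAhlforsRegular μ df)
    {ι : Type*} (e : HilbertBasis ι ℂ (Lp ℂ 2 μ)) (g : ι → C(X, ℂ))
    (hg : ∀ i, e i = toL2 μ (g i)) : Infinite ι := by
  have := hμ.isOpenPosMeasure
  by_contra hfin
  have := fintypeOfNotInfinite hfin
  obtain ⟨C, hC1, hC⟩ := hμ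
  have hD : 0 < Metric.diam (Set.univ : Set X) :=
    Metric.diam_pos Set.nontrivial_univ isCompact_univ.isBounded
  obtain ⟨x⟩ := (inferInstance : Nonempty X)
  set S := ∑ i, ‖g i‖ ^ 2 with hS
  -- Parseval for the indicator of a ball of mass `m` gives `m ≤ S * m ^ 2`, hence `1 ≤ S * m`. This
  -- contradicts `m ≤ C * r ^ df` as `r` tends to `0`.
  have key : ∀ r : ℝ, 0 < r → r < Metric.diam (Set.univ : Set X) → 1 ≤ S * (C * r ^ df) := by
    intro r hr hrD
    set B := Metric.closedBall x r with hB
    have hBm : MeasurableSet B := Metric.isClosed_closedBall.measurableSet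
    set m := μ.real B with hm
    have hm0 : 0 < m := lt_of_lt_of_le (by positivity)
      (ofReal_rpow_le_measure_closedBall hC hr.le hrD)
    have hmC : m ≤ C * r ^ df := ENNReal.toReal_le_of_le_ofReal (by positivity) (hC x r hr.le hrD).2
    set u : Lp ℂ 2 μ := indicatorConstLp 2 hBm (measure_ne_top _ _) 1 with hu
    have h1 : ∀ i, ‖⟪e i, u⟫_ℂ‖ ≤ ‖g i‖ * m := fun i => by
      rw [← inner_conj_symm, RCLike.norm_conj, hu,
        L2.inner_indicatorConstLp_one hBm (measure_ne_top _ _), hg]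
      refine norm_setIntegral_le_of_norm_le_const_ae (measure_lt_top _ _) ?_
      filter_upwards [ae_restrict_of_ae (ContinuousMap.coeFn_toLp (𝕜 := ℂ) (p := 2) μ (g i))]
        with y hy
      rw [hy]
      exact (g i).norm_coe_le_norm y
    have h2 : ‖u‖ ^ 2 = m := by
      rw [hu, norm_indicatorConstLp (by simp) (by simp), norm_one, one_mul,
        ← Real.rpow_natCast, ← Real.rpow_mul (by positivity)]
      norm_num
      rfl
    have h3 : ‖u‖ ^ 2 = ∑ i, ‖⟪e i, u⟫_ℂ‖ ^ 2 := by
      have h := congrArg ENNReal.toReal (tsum_enorm_inner_sq e u)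
      rw [tsum_fintype, ENNReal.toReal_sum (by simp)] at h
      simpa using h.symm
    have h4 : m ≤ S * m * m := by
      refine (h2.symm.trans h3).le.trans ?_
      rw [hS, Finset.sum_mul, Finset.sum_mul]
      refine Finset.sum_le_sum fun i _ => ?_
      refine (pow_le_pow_left₀ (norm_nonneg _) (h1 i) 2).trans (le_of_eq (by ring))
    have h5 : 1 ≤ S * m := by
      by_contra! h
      nlinarith
    have hS0 : 0 ≤ S := by positivity
    exact h5.trans (by gcongr)
  have hlim : Tendsto (fun r : ℝ => S * (C * r ^ df)) (𝓝[>] 0) (𝓝 0) := by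
    have := ((tendsto_id (x := 𝓝 (0 : ℝ))).rpow_const (p := df) (Or.inr hdf.le)).const_mul C
    have := this.const_mul S
    simp only [id, Real.zero_rpow hdf.ne', mul_zero] at this
    exact this.mono_left nhdsWithin_le_nhds
  obtain ⟨r, hr1, hr2⟩ := (((tendsto_order.1 hlim).2 1 one_pos).and
    (Ioo_mem_nhdsGT hD)).exists
  linarith [key r hr2.1 hr2.2]

theorem exists_isEigenbasis [Nontrivial X] {s : ℝ} (hdf : 0 < df) (hs : 0 < s)
    (hμ : IsAhlforsRegular μ df)
    (hd : Dense (sobolev ℂ μ df (df / 2 + s) : Set (Lp ℂ 2 μ))) :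
    ∃ (ev : ℕ → ℝ) (ef : ℕ → C(X, ℂ)), IsEigenbasis μ df (df / 2 + s) ev ef := by
  have hc : IsCompactOperator (resolvent μ df (df / 2 + s)) :=
    (isCompactOperator_formIncl hdf hs hμ).comp_clm _
  obtain ⟨ι, v, κ, hvo, hvG, hvt⟩ := exists_orthonormal_eigenvectors hc
    isSelfAdjoint_resolvent.isSymmetric
  have hκ : ∀ i, 0 < κ i := fun i => (eigenvalue_of_resolvent hd (hvo.1 i) (hvG i)).1
  have hgr : ∀ i, (v i, (((κ i)⁻¹ - 1 : ℝ) : ℂ) • v i) ∈ laplacianGraph μ df (df / 2 + s) :=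
    fun i => (eigenvalue_of_resolvent hd (hvo.1 i) (hvG i)).2
  obtain ⟨K, -, hK⟩ := exists_holder_representative hdf hs hμ
  choose g hg _ using fun i => hK (v i) (mem_laplacianGraph_iff.1 (hgr i)).1
  set e := HilbertBasis.mkOfOrthogonalEqBot hvo hvt with he
  have hev : ∀ i, e i = v i := fun i => by rw [he, HilbertBasis.coe_mkOfOrthogonalEqBot]
  have hinf : Infinite ι := infinite_of_hilbertBasis hdf hμ e g fun i => by rw [hev, hg]
  have hcount : Countable ι := by
    have : Fact ((2 : ℝ≥0∞) ≠ ∞) := ⟨by simp⟩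
    exact countable_of_orthonormal hvo
  obtain ⟨σ, hσ⟩ := exists_equiv_nat_monotone (fun i => (κ i)⁻¹ - 1) fun c => by
    have hc0 : 0 < |c| + 1 := by positivity
    -- `κ⁻¹ - 1 ≤ c` forces `κ ≥ (|c| + 1)⁻¹`.
    refine (finite_setOf_le_eigenvalue hc hvo hvG (inv_pos.2 hc0)).subset fun i hi => ?_
    refine inv_le_of_inv_le₀ (hκ i) ?_
    have : (κ i)⁻¹ - 1 ≤ c := hi
    linarith [le_abs_self c]
  have hto : (fun n => toL2 μ (g (σ n))) = v ∘ σ := funext fun n => hg _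
  refine ⟨fun n => (κ (σ n))⁻¹ - 1, fun n => g (σ n), hσ, ?_, ?_, fun n => ?_⟩
  · rw [hto]
    exact hvo.comp _ σ.injective
  · rw [hto, σ.surjective.range_comp, Submodule.dense_iff_topologicalClosure_eq_top]
    exact Submodule.topologicalClosure_eq_top_iff.2 hvt
  · rw [exists_laplacian_eq_iff hd, hg]
    exact hgr _

end Eigenbasis

/-! ### States of `C(X)` are unital -/

section States

variable {Y : Type*} [TopologicalSpace Y] [CompactSpace Y]

theorem IsState.nonneg_ofReal {τ : C(Y, ℂ) →L[ℂ] ℂ} (hτ : IsState τ) {h : C(Y, ℝ)}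
    (hh : 0 ≤ h) : 0 ≤ τ (ContinuousLinearMap.compLeftContinuous ℝ Y Complex.ofRealCLM h) := by
  set k : C(Y, ℂ) := ContinuousLinearMap.compLeftContinuous ℝ Y Complex.ofRealCLM
    ⟨fun y => √(h y), h.continuous.sqrt⟩ with hk
  convert hτ.1 k using 2
  ext y
  have : (√(h y) : ℂ) * √(h y) = h y := by
    exact_mod_cast Real.mul_self_sqrt (hh y)
  simp [hk, this]

/-- Positivity gives `‖τ‖ ≤ τ 1`: for real `h`, apply `τ` to `‖h‖ - h ≥ 0`; for complex `f`, first
rotate so that `τ f` is nonnegative. Thus the difference of two states kills constants. -/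
theorem IsState.apply_one {τ : C(Y, ℂ) →L[ℂ] ℂ} (hτ : IsState τ) : τ 1 = 1 := by
  set R := ContinuousLinearMap.compLeftContinuous ℝ Y Complex.ofRealCLM with hR
  have h1 : R 1 = 1 := by
    ext y
    simp [hR]
  have hτ1 : 0 ≤ τ 1 := by
    rw [← h1]
    exact hτ.nonneg_ofReal zero_le_one
  have ht : τ 1 = ((τ 1).re : ℂ) := (Complex.eq_re_of_ofReal_le hτ1)
  have ht0 : 0 ≤ (τ 1).re := (Complex.nonneg_iff.1 hτ1).1
  have hreal : ∀ h : C(Y, ℝ), (τ (R h)).re ≤ (τ 1).re * ‖h‖ ∧ (τ (R h)).im = 0 := fun h => by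
    have h2 : R (‖h‖ • 1 - h) = (‖h‖ : ℂ) • 1 - R h := by
      ext y
      simp [hR]
    have h3 : 0 ≤ τ (R (‖h‖ • 1 - h)) := hτ.nonneg_ofReal fun y => by
      simpa using (le_abs_self _).trans (h.norm_coe_le_norm y)
    rw [h2, map_sub, map_smul, ht, smul_eq_mul, ← Complex.ofReal_mul, Complex.nonneg_iff] at h3
    simp only [Complex.sub_re, Complex.ofReal_re, Complex.sub_im, Complex.ofReal_im] at h3
    exact ⟨by linarith [h3.1], by linarith [h3.2]⟩
  have hre : ∀ g : C(Y, ℂ), (τ g).re ≤ (τ 1).re * ‖g‖ := fun g => by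
    have h2 : g = R (ContinuousLinearMap.compLeftContinuous ℝ Y Complex.reCLM g) +
        Complex.I • R (ContinuousLinearMap.compLeftContinuous ℝ Y Complex.imCLM g) := by
      ext y
      simp [hR, mul_comm Complex.I, Complex.re_add_im]
    have h3 : (τ g).re =
        (τ (R (ContinuousLinearMap.compLeftContinuous ℝ Y Complex.reCLM g))).re := by
      conv_lhs => rw [h2]
      rw [map_add, map_smul, Complex.add_re, smul_eq_mul, Complex.mul_re, (hreal _).2]
      simp
    rw [h3]
    refine (hreal _).1.trans (mul_le_mul_of_nonneg_left ?_ ht0)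
    rw [ContinuousMap.norm_le _ (norm_nonneg _)]
    exact fun y => (Complex.abs_re_le_norm _).trans (g.norm_coe_le_norm y)
  have hle : ‖τ‖ ≤ (τ 1).re := by
    refine ContinuousLinearMap.opNorm_le_bound _ ht0 fun f => ?_
    rcases eq_or_ne (τ f) 0 with h0 | h0
    · rw [h0, norm_zero]
      positivity
    have hn : (‖τ f‖ : ℂ) ≠ 0 := by exact_mod_cast norm_ne_zero_iff.2 h0
    -- Multiplication by the conjugate phase of `τ f` preserves the norm bound and turns the value
    -- into `‖τ f‖`.
    have h4 := hre (((starRingEnd ℂ) (τ f) / ‖τ f‖) • f)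
    rw [map_smul, smul_eq_mul, div_mul_eq_mul_div, mul_comm, Complex.mul_conj,
      Complex.normSq_eq_norm_sq, norm_smul, norm_div, RCLike.norm_conj, Complex.norm_real,
      norm_norm, div_self (norm_ne_zero_iff.2 h0), one_mul, Complex.ofReal_pow, pow_two,
      mul_div_assoc, div_self hn, mul_one, Complex.ofReal_re] at h4
    exact h4
  rw [hτ.2] at hle
  have hle' : (τ 1).re ≤ 1 := by
    have h5 := (Complex.re_le_norm _).trans (τ.le_opNorm 1)
    rw [hτ.2, one_mul] at h5
    refine h5.trans ((ContinuousMap.norm_le _ zero_le_one).2 fun y => by simp)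
  rw [ht, le_antisymm hle' hle, Complex.ofReal_one]

end States

/-! ### The gradient seminorm and functionals that kill constants -/

section Gradient

variable {X : Type*} [MetricSpace X] [MeasurableSpace X] [CompactSpace X] [BorelSpace X]
  {μ : Measure X} [IsFiniteMeasure μ] {df a : ℝ}

/-- The form domain with the form norm is linearly equivalent to the Sobolev space. -/
def formEquiv (μ : Measure X) [IsFiniteMeasure μ] (df a : ℝ) :
    formGraph μ df a ≃ₗ[ℂ] sobolev ℂ μ df a :=
  LinearEquiv.ofBijective
    ((formIncl μ df a : formGraph μ df a →ₗ[ℂ] Lp ℂ 2 μ).codRestrict (sobolev ℂ μ df a)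
      fun z => fst_mem_sobolev z.2) <| by
    refine ⟨fun z w hzw => ?_, fun f => ?_⟩
    · have h1 : z.1.fst = w.1.fst := congrArg Subtype.val hzw
      have h2 : z.1.snd = w.1.snd := Lp.ext <| by
        refine (mem_formGraph.1 z.2).trans ?_
        rw [h1]
        exact (mem_formGraph.1 w.2).symm
      exact Subtype.ext (WithLp.ofLp_injective 2 (Prod.ext h1 h2))
    · obtain ⟨z, hz, hzf⟩ := exists_mem_formGraph f.2
      exact ⟨⟨z, hz⟩, Subtype.ext hzf⟩

theorem fst_formEquiv_symm (f : sobolev ℂ μ df a) : ((formEquiv μ df a).symm f).1.fst = f :=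
  congrArg Subtype.val ((formEquiv μ df a).apply_symm_apply f)

/-- The normalized difference quotient as a linear map on the Sobolev space. -/
def grad (μ : Measure X) [IsFiniteMeasure μ] (df a : ℝ) :
    sobolev ℂ μ df a →ₗ[ℂ] Lp ℂ 2 (μ.prod μ) :=
  (WithLp.sndL 2 ℂ (Lp ℂ 2 μ) (Lp ℂ 2 (μ.prod μ)) : _ →ₗ[ℂ] Lp ℂ 2 (μ.prod μ)) ∘ₗ
    (formGraph μ df a).subtype ∘ₗ (formEquiv μ df a).symm.toLinearMap

theorem grad_apply (f : sobolev ℂ μ df a) :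
    grad μ df a f = ((formEquiv μ df a).symm f).1.snd := rfl

theorem inner_grad (f g : sobolev ℂ μ df a) :
    ⟪grad μ df a f, grad μ df a g⟫_ℂ = form μ df a f g := by
  rw [grad_apply, grad_apply, inner_snd_eq_form (Subtype.prop _) (Subtype.prop _),
    fst_formEquiv_symm, fst_formEquiv_symm]

/-- The form carries a factor `1 / 2` that the energy lacks; this `2` becomes the `1 / 2` in the
distance formula. -/
theorem energy_eq_grad (f : sobolev ℂ μ df a) :
    energy μ df a (f : Lp ℂ 2 μ) = 2 * ‖grad μ df a f‖ₑ ^ 2 := by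
  rw [grad_apply, ← energy_fst_eq (Subtype.prop _), fst_formEquiv_symm]

theorem toReal_energy_eq_grad (f : sobolev ℂ μ df a) :
    (energy μ df a (f : Lp ℂ 2 μ)).toReal = 2 * ‖grad μ df a f‖ ^ 2 := by
  simp [energy_eq_grad]

theorem energy_toL2_one : energy μ df a (toL2 μ 1) = 0 := by
  rw [energy_coe_toL2]
  simp [energy]

theorem toL2_one_mem_sobolev : toL2 μ 1 ∈ sobolev ℂ μ df a := by
  change energy μ df a _ < ∞
  rw [energy_toL2_one]
  exact ENNReal.zero_lt_top

theorem grad_toL2_one : grad μ df a ⟨toL2 μ 1, toL2_one_mem_sobolev⟩ = 0 := by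
  have h := energy_eq_grad (⟨toL2 μ 1, toL2_one_mem_sobolev⟩ : sobolev ℂ μ df a)
  rw [energy_toL2_one] at h
  simpa using h.symm

/-- Zero energy makes the Hölder constant of the representative zero. -/
theorem exists_eq_smul_of_grad_eq_zero [Nontrivial X] {s : ℝ} (hdf : 0 < df) (hs : 0 < s)
    (hμ : IsAhlforsRegular μ df) (f : sobolev ℂ μ df (df / 2 + s))
    (hf : grad μ df (df / 2 + s) f = 0) : ∃ c : ℂ, (f : Lp ℂ 2 μ) = c • toL2 μ 1 := by
  obtain ⟨K, -, hK⟩ := exists_holder_representative hdf hs hμ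
  obtain ⟨g, hg, hg'⟩ := hK f f.2
  rw [toReal_energy_eq_grad, hf] at hg'
  obtain ⟨x⟩ := (inferInstance : Nonempty X)
  refine ⟨g x, ?_⟩
  rw [← hg, ← map_smul]
  congr 1
  ext y
  have := hg' y x
  simp only [norm_zero, ne_eq, OfNat.ofNat_ne_zero, not_false_eq_true, zero_pow, mul_zero,
    Real.sqrt_zero, zero_mul, norm_le_zero_iff] at this
  simpa using sub_eq_zero.1 this

/-- A functional on `C(X)` that kills constants is bounded for the seminorm of the form. -/
theorem exists_norm_apply_le_grad [Nontrivial X] {s : ℝ} (hdf : 0 < df) (hs : 0 < s)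
    (hμ : IsAhlforsRegular μ df) (φ : C(X, ℂ) →L[ℂ] ℂ) (hφ : φ 1 = 0) :
    ∃ M : ℝ, 0 ≤ M ∧ ∀ (f : C(X, ℂ)) (hf : toL2 μ f ∈ sobolev ℂ μ df (df / 2 + s)),
      ‖φ f‖ ≤ M * ‖grad μ df (df / 2 + s) ⟨toL2 μ f, hf⟩‖ := by
  have := hμ.isOpenPosMeasure
  obtain ⟨K, hK0, hK⟩ := exists_holder_representative hdf hs hμ
  set D := Metric.diam (Set.univ : Set X) with hD
  have hD0 : 0 ≤ D := Metric.diam_nonneg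
  refine ⟨‖φ‖ * (K * √2 * D ^ s), by positivity, fun f hf => ?_⟩
  obtain ⟨g, hg, hg'⟩ := hK _ hf
  obtain rfl : g = f := ContinuousMap.toLp_injective (𝕜 := ℂ) μ hg
  have hE := toReal_energy_eq_grad (⟨toL2 μ g, hf⟩ : sobolev ℂ μ df (df / 2 + s))
  simp only at hE
  rw [hE, Real.sqrt_mul (by norm_num), Real.sqrt_sq (norm_nonneg _)] at hg'
  obtain ⟨x⟩ := (inferInstance : Nonempty X)
  -- Since `φ` kills constants, only the oscillation of `g` matters, and the Hölder estimate bounds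
  -- it by the gradient.
  have h1 : φ g = φ (g - g x • 1) := by rw [map_sub, map_smul, hφ, smul_zero, sub_zero]
  rw [h1]
  refine (φ.le_opNorm _).trans ?_
  rw [mul_assoc]
  refine mul_le_mul_of_nonneg_left ?_ (norm_nonneg _)
  rw [ContinuousMap.norm_le _ (by positivity)]
  intro y
  calc ‖(g - g x • 1) y‖ = ‖g y - g x‖ := by simp
    _ ≤ _ := hg' y x
    _ ≤ K * (√2 * ‖grad μ df (df / 2 + s) ⟨toL2 μ g, hf⟩‖) * D ^ s := by
        gcongr
        exact Metric.dist_le_diam_of_mem isCompact_univ.isBounded (Set.mem_univ _) (Set.mem_univ _)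
    _ = _ := by ring

end Gradient

/-! ### Energies of eigenfunctions and the bottom of the spectrum -/

namespace IsEigenbasis

variable {X : Type*} [MetricSpace X] [MeasurableSpace X] [CompactSpace X] [BorelSpace X]
  {μ : Measure X} [IsFiniteMeasure μ] {df a : ℝ} {ev : ℕ → ℝ} {ef : ℕ → C(X, ℂ)}

theorem mem_laplacianGraph (hd : Dense (sobolev ℂ μ df a : Set (Lp ℂ 2 μ)))
    (h : IsEigenbasis μ df a ev ef) (n : ℕ) :
    (toL2 μ (ef n), (ev n : ℂ) • toL2 μ (ef n)) ∈ laplacianGraph μ df a :=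
  (exists_laplacian_eq_iff hd).1 (h.eigen n)

theorem mem_sobolev (hd : Dense (sobolev ℂ μ df a : Set (Lp ℂ 2 μ)))
    (h : IsEigenbasis μ df a ev ef) (n : ℕ) : toL2 μ (ef n) ∈ sobolev ℂ μ df a :=
  (mem_laplacianGraph_iff.1 (h.mem_laplacianGraph hd n)).1

/-- The eigenfunctions as elements of the Sobolev space. -/
def toSobolev (hd : Dense (sobolev ℂ μ df a : Set (Lp ℂ 2 μ)))
    (h : IsEigenbasis μ df a ev ef) (n : ℕ) : sobolev ℂ μ df a :=
  ⟨toL2 μ (ef n), h.mem_sobolev hd n⟩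

theorem coe_toSobolev (hd : Dense (sobolev ℂ μ df a : Set (Lp ℂ 2 μ)))
    (h : IsEigenbasis μ df a ev ef) (n : ℕ) : (h.toSobolev hd n : Lp ℂ 2 μ) = toL2 μ (ef n) := rfl

theorem inner_grad_right (hd : Dense (sobolev ℂ μ df a : Set (Lp ℂ 2 μ)))
    (h : IsEigenbasis μ df a ev ef) (f : sobolev ℂ μ df a) (n : ℕ) :
    ⟪grad μ df a f, grad μ df a (h.toSobolev hd n)⟫_ℂ =
      ev n * ⟪(f : Lp ℂ 2 μ), toL2 μ (ef n)⟫_ℂ := by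
  rw [inner_grad, coe_toSobolev,
    (mem_laplacianGraph_iff.1 (h.mem_laplacianGraph hd n)).2 _ f.2, inner_smul_right]

theorem inner_grad_toSobolev (hd : Dense (sobolev ℂ μ df a : Set (Lp ℂ 2 μ)))
    (h : IsEigenbasis μ df a ev ef) (m n : ℕ) :
    ⟪grad μ df a (h.toSobolev hd m), grad μ df a (h.toSobolev hd n)⟫_ℂ =
      if m = n then (ev n : ℂ) else 0 := by
  rw [inner_grad_right, coe_toSobolev, orthonormal_iff_ite.1 h.orthonormal m n]
  simp

theorem norm_grad_toSobolev_sq (hd : Dense (sobolev ℂ μ df a : Set (Lp ℂ 2 μ)))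
    (h : IsEigenbasis μ df a ev ef) (n : ℕ) :
    ‖grad μ df a (h.toSobolev hd n)‖ ^ 2 = ev n := by
  have h1 := h.inner_grad_toSobolev hd n n
  rw [if_pos rfl, inner_self_eq_norm_sq_to_K] at h1
  have h2 : ((‖grad μ df a (h.toSobolev hd n)‖ ^ 2 : ℝ) : ℂ) = ev n := by
    rw [← h1]
    simp
  exact Complex.ofReal_injective h2

theorem eigenvalue_nonneg (hd : Dense (sobolev ℂ μ df a : Set (Lp ℂ 2 μ)))
    (h : IsEigenbasis μ df a ev ef) (n : ℕ) : 0 ≤ ev n := by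
  rw [← h.norm_grad_toSobolev_sq hd n]
  positivity

theorem norm_grad_sum_sq (hd : Dense (sobolev ℂ μ df a : Set (Lp ℂ 2 μ)))
    (h : IsEigenbasis μ df a ev ef) (s : Finset ℕ) (c : ℕ → ℂ) :
    ‖grad μ df a (∑ n ∈ s, c n • h.toSobolev hd n)‖ ^ 2 = ∑ n ∈ s, ‖c n‖ ^ 2 * ev n := by
  have h1 : (((‖grad μ df a (∑ n ∈ s, c n • h.toSobolev hd n)‖ ^ 2 : ℝ)) : ℂ) =
      ((∑ n ∈ s, ‖c n‖ ^ 2 * ev n : ℝ) : ℂ) := by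
    have h2 := inner_self_eq_norm_sq_to_K (𝕜 := ℂ) (grad μ df a (∑ n ∈ s, c n • h.toSobolev hd n))
    push_cast
    refine h2.symm.trans ?_
    rw [map_sum, sum_inner]
    refine Finset.sum_congr rfl fun m hm => ?_
    rw [inner_sum]
    simp_rw [map_smul, inner_smul_left, inner_smul_right, h.inner_grad_toSobolev hd]
    simp only [mul_ite, mul_zero]
    rw [Finset.sum_ite_eq s m, if_pos hm, ← mul_assoc, mul_comm ((starRingEnd ℂ) _),
      Complex.mul_conj, Complex.normSq_eq_norm_sq]
    push_cast
    rfl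
  exact Complex.ofReal_injective h1

/-- Finite linear combinations of eigenfunctions are dense in the Sobolev space. -/
theorem exists_norm_grad_sub_lt (hd : Dense (sobolev ℂ μ df a : Set (Lp ℂ 2 μ)))
    (h : IsEigenbasis μ df a ev ef) (f : sobolev ℂ μ df a) {ε : ℝ} (hε : 0 < ε) :
    ∃ c : ℕ →₀ ℂ, ‖grad μ df a (f - ∑ n ∈ c.support, c n • h.toSobolev hd n)‖ < ε := by
  set e : ℕ → formGraph μ df a := fun n => (formEquiv μ df a).symm (h.toSobolev hd n) with he
  have hperp : (Submodule.span ℂ (Set.range e))ᗮ = ⊥ := by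
    rw [Submodule.eq_bot_iff]
    intro z hz
    -- In the form inner product, orthogonality to the `n`-th eigenfunction reads `(1 + ev n) *
    -- ⟪z.1.fst, toL2 μ (ef n)⟫ = 0`, with a nonzero factor.
    have h1 : ∀ n, ⟪z.1.fst, toL2 μ (ef n)⟫_ℂ = 0 := fun n => by
      have h2 : ⟪z, e n⟫_ℂ = 0 :=
        (Submodule.mem_orthogonal' _ _).1 hz _ (Submodule.subset_span ⟨n, rfl⟩)
      rw [Submodule.coe_inner, inner_eq_inner_add_form z.2 (e n).2, fst_formEquiv_symm,
        coe_toSobolev,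
        (mem_laplacianGraph_iff.1 (h.mem_laplacianGraph hd n)).2 _ (fst_mem_sobolev z.2),
        inner_smul_right, ← one_add_mul] at h2
      refine (mul_eq_zero.1 h2).resolve_left ?_
      have := h.eigenvalue_nonneg hd n
      have h3 : (1 + ev n : ℝ) ≠ 0 := by positivity
      exact_mod_cast h3
    have h4 : z.1.fst = 0 := by
      refine h.dense_span.eq_zero_of_inner_left ℂ fun v hv => ?_
      refine Submodule.span_induction (p := fun v _ => ⟪z.1.fst, v⟫_ℂ = 0) ?_ ?_ ?_ ?_ hv
      · rintro _ ⟨n, rfl⟩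
        exact h1 n
      · exact inner_zero_right _
      · intro x y _ _ hx hy
        rw [inner_add_right, hx, hy, add_zero]
      · intro c x _ hx
        rw [inner_smul_right, hx, mul_zero]
    refine (formEquiv μ df a).injective (Subtype.ext ?_)
    rw [map_zero]
    exact h4
  have hdense : Dense (Submodule.span ℂ (Set.range e) : Set (formGraph μ df a)) :=
    Submodule.dense_iff_topologicalClosure_eq_top.2
      (Submodule.topologicalClosure_eq_top_iff.2 hperp)
  obtain ⟨y, hy, hy'⟩ := Metric.dense_iff.1 hdense ((formEquiv μ df a).symm f) ε hε
  obtain ⟨c, rfl⟩ := (Finsupp.mem_span_range_iff_exists_finsupp).1 hy'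
  refine ⟨c, ?_⟩
  rw [Metric.mem_ball, dist_comm, dist_eq_norm] at hy
  refine lt_of_le_of_lt ?_ hy
  have h5 : (formEquiv μ df a).symm f - (c.sum fun i a => a • e i) =
      (formEquiv μ df a).symm (f - ∑ n ∈ c.support, c n • h.toSobolev hd n) := by
    rw [map_sub, map_sum]
    simp only [map_smul]
    rfl
  rw [h5, grad_apply]
  exact WithLp.norm_snd_le _ _

variable [Nontrivial X] {s : ℝ}

/-- Pairing the constant `1` with an eigenfunction in the form gives `0 = ev n * ⟪1, ef n⟫`. If no
eigenvalue vanished, `1` would be orthogonal to a total family. Monotonicity puts the zero at index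
`0`. -/
theorem eigenvalue_zero (hμ : IsAhlforsRegular μ df)
    (hd : Dense (sobolev ℂ μ df a : Set (Lp ℂ 2 μ))) (h : IsEigenbasis μ df a ev ef) :
    ev 0 = 0 := by
  have := hμ.isOpenPosMeasure
  refine le_antisymm ?_ (h.eigenvalue_nonneg hd 0)
  obtain ⟨n, hn⟩ : ∃ n, ev n = 0 := by
    by_contra! hne
    refine toL2_one_ne_zero (μ := μ) ?_
    refine h.dense_span.eq_zero_of_inner_left ℂ fun v hv => ?_
    refine Submodule.span_induction (p := fun v _ => ⟪toL2 μ 1, v⟫_ℂ = 0) ?_ ?_ ?_ ?_ hv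
    · rintro _ ⟨n, rfl⟩
      have h1 := h.inner_grad_right hd ⟨toL2 μ 1, toL2_one_mem_sobolev⟩ n
      rw [grad_toL2_one, inner_zero_left] at h1
      exact (mul_eq_zero.1 h1.symm).resolve_left (by exact_mod_cast hne n)
    · exact inner_zero_right _
    · intro x y _ _ hx hy
      rw [inner_add_right, hx, hy, add_zero]
    · intro c x _ hx
      rw [inner_smul_right, hx, mul_zero]
  exact hn ▸ h.mono (Nat.zero_le n)

/-- A second zero eigenvalue would give two orthonormal eigenfunctions that are both constant. -/
theorem eigenvalue_succ_pos (hdf : 0 < df) (hs : 0 < s) (hμ : IsAhlforsRegular μ df)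
    (hd : Dense (sobolev ℂ μ df (df / 2 + s) : Set (Lp ℂ 2 μ)))
    (h : IsEigenbasis μ df (df / 2 + s) ev ef) (n : ℕ) : 0 < ev (n + 1) := by
  refine lt_of_le_of_ne (h.eigenvalue_nonneg hd _) fun h0 => ?_
  have hconst : ∀ m, ev m = 0 → ∃ c : ℂ, toL2 μ (ef m) = c • toL2 μ 1 := fun m hm => by
    refine exists_eq_smul_of_grad_eq_zero hdf hs hμ (h.toSobolev hd m) ?_
    have := h.norm_grad_toSobolev_sq hd m
    rw [hm] at this
    simpa using this
  obtain ⟨c, hc⟩ := hconst 0 (h.eigenvalue_zero hμ hd)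
  obtain ⟨c', hc'⟩ := hconst (n + 1) h0.symm
  have h1 : ⟪toL2 μ (ef 0), toL2 μ (ef (n + 1))⟫_ℂ = 0 := h.orthonormal.2 (by simp)
  have hne := h.orthonormal.ne_zero 0
  have hne' := h.orthonormal.ne_zero (n + 1)
  simp only [hc, hc'] at h1 hne hne'
  rw [inner_smul_left, inner_smul_right] at h1
  rw [smul_ne_zero_iff] at hne hne'
  simp [hne.1, hne'.1, hne.2] at h1

end IsEigenbasis

/-! ### The dual norm in eigenfunction coordinates -/

namespace IsEigenbasis

variable {X : Type*} [MetricSpace X] [MeasurableSpace X] [CompactSpace X] [BorelSpace X]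
  {μ : Measure X} [IsFiniteMeasure μ] {df s : ℝ} {ev : ℕ → ℝ} {ef : ℕ → C(X, ℂ)}

theorem toL2_sum {a : ℝ} (hd : Dense (sobolev ℂ μ df a : Set (Lp ℂ 2 μ)))
    (h : IsEigenbasis μ df a ev ef) (t : Finset ℕ) (c : ℕ → ℂ) :
    toL2 μ (∑ n ∈ t, c n • ef n) = (∑ n ∈ t, c n • h.toSobolev hd n : sobolev ℂ μ df a) := by
  simp [coe_toSobolev]

variable [Nontrivial X]

/-- On finite linear combinations of eigenfunctions, a functional that kills constants is
dominated by the energy. -/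
theorem norm_apply_sum_sq_le (hdf : 0 < df) (hs : 0 < s) (hμ : IsAhlforsRegular μ df)
    (hd : Dense (sobolev ℂ μ df (df / 2 + s) : Set (Lp ℂ 2 μ)))
    (h : IsEigenbasis μ df (df / 2 + s) ev ef) (φ : C(X, ℂ) →L[ℂ] ℂ) (hφ : φ 1 = 0)
    (t : Finset ℕ) (c : ℕ → ℂ) :
    ‖φ (∑ n ∈ t, c n • ef n)‖ ^ 2 ≤
      ‖grad μ df (df / 2 + s) (∑ n ∈ t, c n • h.toSobolev hd n)‖ ^ 2 *
        ∑ n ∈ t, (ev n)⁻¹ * ‖φ (ef n)‖ ^ 2 := by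
  rw [h.norm_grad_sum_sq hd]
  have hev := h.eigenvalue_nonneg hd
  -- On the right the term `n = 0` is zero, since `(0 : ℝ)⁻¹ = 0`, so it has to vanish on the left
  -- as well.
  have h0 : φ (ef 0) = 0 := by
    obtain ⟨M, -, hM⟩ := exists_norm_apply_le_grad hdf hs hμ φ hφ
    have h1 := hM (ef 0) (h.mem_sobolev hd 0)
    have h2 := h.norm_grad_toSobolev_sq hd 0
    rw [h.eigenvalue_zero hμ hd, sq_eq_zero_iff] at h2
    have h3 : ‖φ (ef 0)‖ ≤ M * ‖grad μ df (df / 2 + s) (h.toSobolev hd 0)‖ := h1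
    rw [h2, mul_zero] at h3
    exact norm_le_zero_iff.1 h3
  have h4 : ‖φ (∑ n ∈ t, c n • ef n)‖ ≤ ∑ n ∈ t, ‖c n‖ * ‖φ (ef n)‖ := by
    rw [map_sum]
    refine (norm_sum_le _ _).trans (le_of_eq ?_)
    simp only [map_smul, norm_smul]
  refine (pow_le_pow_left₀ (norm_nonneg _) h4 2).trans ?_
  -- Cauchy–Schwarz with weights `ev n` and `(ev n)⁻¹`.
  refine Finset.sum_sq_le_sum_mul_sum_of_sq_le_mul _ (fun n _ => ?_) (fun n _ => ?_)
    fun n _ => ?_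
  · exact mul_nonneg (by positivity) (hev n)
  · exact mul_nonneg (inv_nonneg.2 (hev n)) (by positivity)
  · rcases n with _ | n
    · simp [h0, h.eigenvalue_zero hμ hd]
    · have := h.eigenvalue_succ_pos hdf hs hμ hd n
      refine le_of_eq ?_
      field_simp

/-- The truncated Riesz representer of a functional with respect to the form. -/
theorem apply_sum_eq {a : ℝ} (hd : Dense (sobolev ℂ μ df a : Set (Lp ℂ 2 μ)))
    (h : IsEigenbasis μ df a ev ef) (φ : C(X, ℂ) →L[ℂ] ℂ) (t : Finset ℕ) :
    φ (∑ n ∈ t, ((ev n : ℂ)⁻¹ * (starRingEnd ℂ) (φ (ef n))) • ef n) =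
        ((∑ n ∈ t, (ev n)⁻¹ * ‖φ (ef n)‖ ^ 2 : ℝ) : ℂ) ∧
      ‖grad μ df a
        (∑ n ∈ t, ((ev n : ℂ)⁻¹ * (starRingEnd ℂ) (φ (ef n))) • h.toSobolev hd n)‖ ^ 2 =
        ∑ n ∈ t, (ev n)⁻¹ * ‖φ (ef n)‖ ^ 2 := by
  constructor
  · rw [map_sum]
    push_cast
    refine Finset.sum_congr rfl fun n _ => ?_
    rw [map_smul, smul_eq_mul, mul_assoc, mul_comm ((starRingEnd ℂ) _), Complex.mul_conj,
      Complex.normSq_eq_norm_sq]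
    push_cast
    rfl
  · rw [h.norm_grad_sum_sq hd]
    refine Finset.sum_congr rfl fun n _ => ?_
    rw [norm_mul, RCLike.norm_conj, norm_inv, Complex.norm_real,
      Real.norm_of_nonneg (h.eigenvalue_nonneg hd n)]
    rcases eq_or_ne (ev n) 0 with h0 | h0
    · simp [h0]
    · field_simp

/-- For the truncated Riesz representer `g`, both `φ g` and the squared gradient norm equal the
partial sum `S`. The bound `‖φ g‖ ≤ M * ‖grad g‖` gives `S ^ 2 ≤ M ^ 2 * S`, hence `S ≤ M ^ 2`. -/
theorem summable_inv_mul_sq (hdf : 0 < df) (hs : 0 < s) (hμ : IsAhlforsRegular μ df)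
    (hd : Dense (sobolev ℂ μ df (df / 2 + s) : Set (Lp ℂ 2 μ)))
    (h : IsEigenbasis μ df (df / 2 + s) ev ef) (φ : C(X, ℂ) →L[ℂ] ℂ) (hφ : φ 1 = 0) :
    Summable fun n => (ev n)⁻¹ * ‖φ (ef n)‖ ^ 2 := by
  obtain ⟨M, hM0, hM⟩ := exists_norm_apply_le_grad hdf hs hμ φ hφ
  refine summable_of_sum_range_le (c := M ^ 2)
    (fun n => mul_nonneg (inv_nonneg.2 (h.eigenvalue_nonneg hd n)) (by positivity)) fun N => ?_
  obtain ⟨h1, h2⟩ := h.apply_sum_eq hd φ (Finset.range N)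
  set S := ∑ n ∈ Finset.range N, (ev n)⁻¹ * ‖φ (ef n)‖ ^ 2 with hS
  set g := ∑ n ∈ Finset.range N, ((ev n : ℂ)⁻¹ * (starRingEnd ℂ) (φ (ef n))) • ef n with hg
  have hS0 : 0 ≤ S := h2 ▸ by positivity
  have hmem : toL2 μ g ∈ sobolev ℂ μ df (df / 2 + s) := by
    rw [hg, h.toL2_sum hd]
    exact Subtype.prop _
  have h3 := hM g hmem
  have h4 : (⟨toL2 μ g, hmem⟩ : sobolev ℂ μ df (df / 2 + s)) = _ :=
    Subtype.ext (h.toL2_sum hd _ _)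
  rw [h4, h1, Complex.norm_real, Real.norm_of_nonneg hS0] at h3
  have h5 := pow_le_pow_left₀ hS0 h3 2
  rw [mul_pow, h2] at h5
  by_contra! hlt
  nlinarith [sq_nonneg M]

/-- The inequality for finite combinations extends by density in the gradient seminorm. The cruder
bound with constant `M` controls `φ` on the remainder. -/
theorem norm_apply_le (hdf : 0 < df) (hs : 0 < s) (hμ : IsAhlforsRegular μ df)
    (hd : Dense (sobolev ℂ μ df (df / 2 + s) : Set (Lp ℂ 2 μ)))
    (h : IsEigenbasis μ df (df / 2 + s) ev ef) (φ : C(X, ℂ) →L[ℂ] ℂ) (hφ : φ 1 = 0)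
    (f : C(X, ℂ)) (hf : toL2 μ f ∈ sobolev ℂ μ df (df / 2 + s)) :
    ‖φ f‖ ≤ √(∑' n, (ev n)⁻¹ * ‖φ (ef n)‖ ^ 2) *
      ‖grad μ df (df / 2 + s) ⟨toL2 μ f, hf⟩‖ := by
  have hsum := h.summable_inv_mul_sq hdf hs hμ hd φ hφ
  set S := ∑' n, (ev n)⁻¹ * ‖φ (ef n)‖ ^ 2 with hS
  obtain ⟨M, hM0, hM⟩ := exists_norm_apply_le_grad hdf hs hμ φ hφ
  have hev := h.eigenvalue_nonneg hd
  set F : sobolev ℂ μ df (df / 2 + s) := ⟨toL2 μ f, hf⟩ with hF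
  have key : ∀ ε : ℝ, 0 < ε →
      ‖φ f‖ ≤ √S * ‖grad μ df (df / 2 + s) F‖ + (√S + M) * ε := by
    intro ε hε
    obtain ⟨c, hc⟩ := h.exists_norm_grad_sub_lt hd F hε
    set G := ∑ n ∈ c.support, c n • h.toSobolev hd n with hG
    set g := ∑ n ∈ c.support, c n • ef n with hg
    have hgG : toL2 μ g = G := h.toL2_sum hd _ _
    have hmem : toL2 μ (f - g) ∈ sobolev ℂ μ df (df / 2 + s) := by
      rw [toL2, map_sub]
      exact Submodule.sub_mem _ hf (hgG ▸ G.2 : toL2 μ g ∈ _)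
    have h1 := hM (f - g) hmem
    have h2 : (⟨toL2 μ (f - g), hmem⟩ : sobolev ℂ μ df (df / 2 + s)) = F - G := by
      refine Subtype.ext ?_
      change toL2 μ (f - g) = toL2 μ f - G
      rw [← hgG, toL2, map_sub]
    rw [h2, map_sub] at h1
    have h3 : ‖φ g‖ ≤ √S * ‖grad μ df (df / 2 + s) G‖ := by
      refine abs_le_of_sq_le_sq' ?_ (by positivity) |>.2
      have hS0 : 0 ≤ S := tsum_nonneg fun n => mul_nonneg (inv_nonneg.2 (hev n)) (by positivity)
      rw [mul_pow, Real.sq_sqrt hS0, mul_comm]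
      refine (h.norm_apply_sum_sq_le hdf hs hμ hd φ hφ _ _).trans ?_
      refine mul_le_mul_of_nonneg_left ?_ (by positivity)
      exact hsum.sum_le_tsum _ fun n _ => mul_nonneg (inv_nonneg.2 (hev n)) (by positivity)
    have h4 : ‖grad μ df (df / 2 + s) G‖ ≤ ‖grad μ df (df / 2 + s) F‖ + ε := by
      rw [map_sub] at hc
      have := norm_sub_norm_le (grad μ df (df / 2 + s) G) (grad μ df (df / 2 + s) F)
      rw [norm_sub_rev] at this
      linarith
    calc ‖φ f‖ = ‖φ g + (φ f - φ g)‖ := by rw [add_sub_cancel]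
      _ ≤ ‖φ g‖ + ‖φ f - φ g‖ := norm_add_le _ _
      _ ≤ √S * (‖grad μ df (df / 2 + s) F‖ + ε) + M * ε :=
          add_le_add (h3.trans (by gcongr)) (h1.trans (by gcongr))
      _ = _ := by ring
  refine le_of_forall_pos_le_add fun δ hδ => ?_
  have hpos : 0 < √S + M + 1 := by positivity
  refine (key (δ / (√S + M + 1)) (by positivity)).trans (add_le_add le_rfl ?_)
  rw [mul_div_assoc', div_le_iff₀ hpos]
  nlinarith

/-- The Monge–Kantorovich metric in terms of an eigenbasis. -/
theorem mkMetric_eq {α β : ℝ} (hdf : 0 < df) (hα : 0 < α) (hβ : β = df / 2 + 2 * α)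
    (hμ : IsAhlforsRegular μ df) (hd : Dense (sobolev ℂ μ df β : Set (Lp ℂ 2 μ)))
    (h : IsEigenbasis μ df β ev ef) {τ₁ τ₂ : C(X, ℂ) →L[ℂ] ℂ} (h₁ : IsState τ₁)
    (h₂ : IsState τ₂) :
    mkMetric μ df α β τ₁ τ₂ = ENNReal.ofReal
      √((1 / 2) * ∑' n, (ev n)⁻¹ * ‖(τ₁ - τ₂) (ef n)‖ ^ 2) := by
  have hdα : Dense (sobolev ℂ μ df α : Set (Lp ℂ 2 μ)) :=
    hd.mono (sobolev_anti (by rw [hβ]; linarith))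
  -- The constraint in the supremum is a ball of the gradient seminorm.
  have hcomm : ∀ (f : C(X, ℂ)) (hf : toL2 μ f ∈ sobolev ℂ μ df β),
      commutatorNorm μ df α f ≤ 1 ↔ 2 * ‖grad μ df β ⟨toL2 μ f, hf⟩‖ ^ 2 ≤ 1 := fun f hf => by
    have hlt : energy μ df β (toL2 μ f) < ∞ := hf
    rw [commutatorNorm_eq hdf hα hβ hμ hdα hf, ← energy_coe_toL2,
      ← toReal_energy_eq_grad ⟨toL2 μ f, hf⟩,
      ← ENNReal.one_rpow (1 / 2), ENNReal.rpow_le_rpow_iff (by norm_num), ← ENNReal.toReal_one,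
      ENNReal.toReal_le_toReal hlt.ne (by simp)]
  subst hβ
  have hs : 0 < 2 * α := by linarith
  set φ := τ₁ - τ₂ with hφdef
  have hφ : φ 1 = 0 := by
    rw [hφdef, sub_apply, h₁.apply_one, h₂.apply_one, sub_self]
  have hsum := h.summable_inv_mul_sq hdf hs hμ hd φ hφ
  refine le_antisymm ?_ ?_
  · refine iSup_le fun f => iSup₂_le fun hf hf' => ?_
    have h3 := (hcomm f hf).1 hf'
    rw [← sub_apply, ← ofReal_norm]
    refine ENNReal.ofReal_le_ofReal ((h.norm_apply_le hdf hs hμ hd φ hφ f hf).trans ?_)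
    rw [mul_comm (1 / 2 : ℝ), Real.sqrt_mul' _ (by norm_num)]
    refine mul_le_mul_of_nonneg_left (Real.le_sqrt_of_sq_le (by linarith)) (Real.sqrt_nonneg _)
  -- For the lower bound, normalized truncated representers attain the partial sums.
  · have hlim : Tendsto (fun N => ENNReal.ofReal √((1 / 2) * ∑ n ∈ Finset.range N,
        (ev n)⁻¹ * ‖φ (ef n)‖ ^ 2)) atTop (𝓝 (ENNReal.ofReal √((1 / 2) *
          ∑' n, (ev n)⁻¹ * ‖φ (ef n)‖ ^ 2))) :=
      (ENNReal.continuous_ofReal.tendsto _).comp ((Real.continuous_sqrt.tendsto _).comp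
        (hsum.hasSum.tendsto_sum_nat.const_mul _))
    refine le_of_tendsto' hlim fun N => ?_
    obtain ⟨h3, h4⟩ := h.apply_sum_eq hd φ (Finset.range N)
    set S := ∑ n ∈ Finset.range N, (ev n)⁻¹ * ‖φ (ef n)‖ ^ 2 with hS
    set g := ∑ n ∈ Finset.range N, ((ev n : ℂ)⁻¹ * (starRingEnd ℂ) (φ (ef n))) • ef n with hg
    set G := ∑ n ∈ Finset.range N,
      ((ev n : ℂ)⁻¹ * (starRingEnd ℂ) (φ (ef n))) • h.toSobolev hd n with hG
    have hgG : toL2 μ g = G := h.toL2_sum hd _ _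
    have hS0 : 0 ≤ S := h4 ▸ by positivity
    rcases hS0.eq_or_lt with h0 | hpos
    · simp [← h0]
    -- With this factor `r • g` lies on the boundary of the ball, and `φ (r • g) = r * S = √(S /
    -- 2)`.
    set r : ℝ := (√(2 * S))⁻¹ with hr
    have hr2 : r ^ 2 * (2 * S) = 1 := by
      rw [hr, inv_pow, Real.sq_sqrt (by positivity), inv_mul_cancel₀ (by positivity)]
    have hr0 : 0 ≤ r := by positivity
    have hmem : toL2 μ ((r : ℂ) • g) ∈ sobolev ℂ μ df (df / 2 + 2 * α) := by
      rw [toL2, map_smul]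
      exact Submodule.smul_mem _ _ (hgG ▸ G.2 : toL2 μ g ∈ _)
    have h5 : (⟨toL2 μ ((r : ℂ) • g), hmem⟩ : sobolev ℂ μ df (df / 2 + 2 * α)) = (r : ℂ) • G := by
      refine Subtype.ext ?_
      change toL2 μ ((r : ℂ) • g) = (r : ℂ) • (G : Lp ℂ 2 μ)
      rw [← hgG, toL2, map_smul]
    have h6 : commutatorNorm μ df α ((r : ℂ) • g) ≤ 1 := by
      rw [hcomm _ hmem, h5, map_smul, norm_smul, mul_pow, h4, Complex.norm_real,
        Real.norm_of_nonneg hr0]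
      linarith
    refine le_trans (le_of_eq ?_) (le_iSup_of_le ((r : ℂ) • g)
      (le_iSup₂_of_le (f := fun _ _ => ‖τ₁ ((r : ℂ) • g) - τ₂ ((r : ℂ) • g)‖ₑ) hmem h6 le_rfl))
    rw [← sub_apply, ← hφdef, map_smul, h3, ← ofReal_norm, norm_smul, Complex.norm_real,
      Complex.norm_real, Real.norm_of_nonneg hr0, Real.norm_of_nonneg hS0]
    congr 1
    rw [Real.sqrt_eq_iff_mul_self_eq (by positivity) (by positivity)]
    linear_combination -(S / 2) * hr2

end IsEigenbasis

end FracLap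

end

/-! ### Assembly of the theorem -/

theorem theoremB {X : Type*} [MetricSpace X] [CompactSpace X] [Nontrivial X]
    [MeasurableSpace X] [BorelSpace X] (μ : MeasureTheory.Measure X)
    [MeasureTheory.IsFiniteMeasure μ] (df α β : ℝ) (hdf : 0 < df)
    (hμ : FracLap.IsAhlforsRegular μ df)
    (hdw : ENNReal.ofReal df < FracLap.walkDim μ df)
    (hα : 0 < 2 * α)
    (hα' : ENNReal.ofReal (2 * α) < min ((FracLap.walkDim μ df - ENNReal.ofReal df) / 2) 1)
    (hβ : β = df / 2 + 2 * α) :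
    (∀ f ∈ FracLap.contSobolev μ df β, FracLap.commutatorNorm μ df α f < ⊤) ∧
    (∃ (ev : ℕ → ℝ) (ef : ℕ → C(X, ℂ)), FracLap.IsEigenbasis μ df β ev ef) ∧
    ∀ (ev : ℕ → ℝ) (ef : ℕ → C(X, ℂ)), FracLap.IsEigenbasis μ df β ev ef →
      ev 0 = 0 ∧ (∀ n, 0 < ev (n + 1)) ∧
      ∀ τ₁ τ₂ : C(X, ℂ) →L[ℂ] ℂ, FracLap.IsState τ₁ → FracLap.IsState τ₂ →
        Summable (fun n : ℕ => (ev (n + 1))⁻¹ * ‖(τ₁ - τ₂) (ef (n + 1))‖ ^ 2) ∧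
        FracLap.mkMetric μ df α β τ₁ τ₂ =
          ENNReal.ofReal (Real.sqrt
            ((1 / 2) * ∑' n : ℕ, (ev (n + 1))⁻¹ * ‖(τ₁ - τ₂) (ef (n + 1))‖ ^ 2)) := by
  have hα0 : 0 < α := by linarith
  -- `2 * β = df + 4 * α`, so this is the bound `2 * α < (d_w - df) / 2` rearranged in `[0, ∞]`.
  have hlt : ENNReal.ofReal (2 * β) < FracLap.walkDim μ df := by
    have h1 := hα'.trans_le (min_le_left _ _)
    rw [ENNReal.lt_div_iff_mul_lt (by simp) (by simp), lt_tsub_iff_right,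
      show (2 : ENNReal) = ENNReal.ofReal 2 by simp, ← ENNReal.ofReal_mul hα.le,
      ← ENNReal.ofReal_add (by positivity) hdf.le] at h1
    convert h1 using 2
    rw [hβ]
    ring
  have hd := FracLap.dense_sobolev_of_lt_walkDim hlt
  have hdα : Dense (FracLap.sobolev ℂ μ df α : Set (MeasureTheory.Lp ℂ 2 μ)) :=
    hd.mono (FracLap.sobolev_anti (by rw [hβ]; linarith))
  refine ⟨fun f hf => ?_, ?_, fun ev ef h => ⟨h.eigenvalue_zero hμ hd, ?_, fun τ₁ τ₂ h₁ h₂ => ?_⟩⟩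
  · rw [FracLap.commutatorNorm_eq hdf hα0 hβ hμ hdα hf, ← FracLap.energy_coe_toL2]
    exact ENNReal.rpow_lt_top_of_nonneg (by norm_num) (ne_of_lt hf)
  · subst hβ
    exact FracLap.exists_isEigenbasis hdf hα hμ hd
  · subst hβ
    exact h.eigenvalue_succ_pos hdf hα hμ hd
  · have hφ : (τ₁ - τ₂) 1 = 0 := by
      rw [sub_apply, h₁.apply_one, h₂.apply_one, sub_self]
    have hsum : Summable fun n => (ev n)⁻¹ * ‖(τ₁ - τ₂) (ef n)‖ ^ 2 := by
      subst hβ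
      exact h.summable_inv_mul_sq hdf hα hμ hd _ hφ
    refine ⟨(summable_nat_add_iff 1).2 hsum, ?_⟩
    -- The series over all `n` and the one from `n = 1` agree because the term at `0` contains `(ev
    -- 0)⁻¹ = 0`.
    rw [h.mkMetric_eq hdf hα0 hβ hμ hd h₁ h₂, hsum.tsum_eq_zero_add, h.eigenvalue_zero hμ hd]
    simp
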